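/- **Conventions.** A cone is a finitely generated convex cone in some $\mathbb{R}^n$; a face of a cone $C$ is $C$ itself or $C\cap H$ with $H$ a linear support hyperplane. A *conical complex* $\Sigma$ is a finite set of sets together with, for each $c\in\Sigma$, a cone $C_c\subseteq\mathbb{R}^{n_c}$ and a bijection $\pi_c\colon C_c\to c$ such that (a) $\pi_c(F)\in\Sigma$ for every face $F$ of $C_c$, and (b) for all $c,d\in\Sigma$ there are faces $F$ of $C_c$ and $G$ of $C_d$ with $c\cap d=\pi_c(F)=\pi_d(G)$ such that $\pi_d^{-1}\circ\pi_c\colon F\to G$ extends to a linear isomorphism $\mathbb{R}F\to\mathbb{R}G$. A *monoidal complex* $\mathcal{M}$ supported on $\Sigma$ consists of finitely generated monoids $M_c\subseteq\mathbb{Z}^{n_c}$ $(c\in\Sigma)$ with $M_c\subseteq C_c$, $\mathbb{R}_+M_c=C_c$, such that $\pi_d^{-1}\circ\pi_c$ restricts to an isomorphism $M_c\cap\pi_c^{-1}(c\cap d)\to M_d\cap\pi_d^{-1}(c\cap d)$ for all $c,d\in\Sigma$. Identify $C_c$ with $c$ via $\pi_c$ and set $|\Sigma|=\bigcup_c c$,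 $|\mathcal{M}|=\bigcup_c M_c\subseteq|\Sigma|$. For a field $K$, the *toric face ring* $K[\mathcal{M}]$ has the $K$-basis $t^a$, $a\in|\mathcal{M}|$, and the multiplication $t^at^b=t^{a+b}$ if $a,b$ lie in a common $M_c$, and $t^at^b=0$ otherwise. Let $(a_e)_{e\in E}$ be a finite family in $|\mathcal{M}|$ such that $\{a_e: e\in E\}\cap M_c$ generates $M_c$ for each $c\in\Sigma$, and let $w=(w_e)_{e\in E}\in\mathbb{N}^E$ be a weight vector (zero entries are allowed). Let $I_{\mathcal{M}}$ be the kernel of $K[X_e:e\in E]\to K[\mathcal{M}]$, $X_e\mapsto t^{a_e}$. Let $\operatorname{in}_w(f)$ be the $w$-homogeneous component of highest degree of $f$, and let $\operatorname{in}_w(I)$ be the ideal generated by all $\operatorname{in}_w(f)$, $f\in I$. For $c\in\Sigma$ let $C'_c\subseteq\mathbb{R}^{n_c}\times\mathbb{R}$ be the cone generated by all $(a_e,w_e)$ with $a_e\in C_c$. Its bottom consists of the points $(x,h)\in C'_c$ with $h=\min\{h':(x,h')\in C'_c\}$. For $x\in|\Sigma|$ let $\operatorname{ht}_w(x)=\min\{h:(x,h)\in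 C'_c\}$, where $c$ is the smallest face of $\Sigma$ that contains $x$. Let $\Gamma_w$ be the collection of the projections $D_d\subseteq C_c$ of the faces of $C'_c$ that are contained in its bottom, for all $c\in\Sigma$ (the regular subdivision of $\Sigma$ defined by $w$). For $d\in\Gamma_w$ let $N_{d,w}$ be the monoid generated by all $a_e\in D_d$ with $\operatorname{ht}_w(a_e)=w_e$. **Theorem.** The cones $D_d$ and the monoids $N_{d,w}$, $d\in\Gamma_w$, form a monoidal complex $\mathcal{M}_w$ supported on the conical complex $\Gamma_w$. Let $J_{\mathcal{M}_w}$ be the kernel of the homomorphism $$K[X_e:e\in E]\to K[\mathcal{M}_w],\qquad X_e\mapsto\begin{cases}t^{a_e}&\text{if }\operatorname{ht}_w(a_e)=w_e,\\0&\text{otherwise.}\end{cases}$$ Then $$J_{\mathcal{M}_w}=\operatorname{Rad}\bigl(\operatorname{in}_w(I_{\mathcal{M}})\bigr).$$ -/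

import Mathlib

/-- The data of a conical complex: a set `faces` (written `Σ` in the comments) of subsets of `X`;
for each `c ∈ Σ` a cone `C_c` in some `ℝⁿ`, and the inverse `chart c = π_c⁻¹ : c → C_c` of the
parametrization `π_c : C_c → c`. (The values of `chart c` outside of `c` carry no meaning.) -/
structure ConeSystem (X : Type*) where
  faces : Set (Set X)
  dim : faces → ℕ
  cone : (c : faces) → PointedCone ℝ (Fin (dim c) → ℝ)
  chart : (c : faces) → X → (Fin (dim c) → ℝ)

/-- The part of the face `c` that the chart of `c` maps into `F`; this is `π_c(F)` for
`F ⊆ C_c`. -/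
def ConeSystem.part {X : Type*} (S : ConeSystem X) (c : S.faces)
    (F : Set (Fin (S.dim c) → ℝ)) : Set X :=
  {x | x ∈ c.1 ∧ S.chart c x ∈ F}

/-- The axioms of a conical complex. In a finitely generated cone `PointedCone.IsFaceOf` describes
the faces cut out by support hyperplanes, and the cone itself. The ambient space `ℝⁿ` of a cone may
be larger than the linear span of the cone. -/
structure ConeSystem.IsConicalComplex {X : Type*} (S : ConeSystem X) : Prop where
  finite : S.faces.Finite
  fg : ∀ c, (S.cone c).FG
  bijOn : ∀ c, Set.BijOn (S.chart c) c.1 (S.cone c)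
  /-- The image in `X` of each face of `C_c` belongs to the complex. -/
  face_mem : ∀ (c : S.faces) (F : PointedCone ℝ (Fin (S.dim c) → ℝ)),
    F.IsFaceOf (S.cone c) → S.part c F ∈ S.faces
  /-- `c ∩ d` is the image of a face `F` of `C_c` and of a face `G` of `C_d`, and the change of
  charts is an isomorphism of cones `F → G`: it extends to a linear isomorphism `ℝF → ℝG`. -/
  inter : ∀ c d : S.faces, ∃ (F : PointedCone ℝ (Fin (S.dim c) → ℝ))
    (G : PointedCone ℝ (Fin (S.dim d) → ℝ)),
    F.IsFaceOf (S.cone c) ∧ G.IsFaceOf (S.cone d) ∧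
    c.1 ∩ d.1 = S.part c F ∧ c.1 ∩ d.1 = S.part d G ∧
    ∃ e : Submodule.span ℝ (F : Set (Fin (S.dim c) → ℝ)) ≃ₗ[ℝ]
        Submodule.span ℝ (G : Set (Fin (S.dim d) → ℝ)),
      ∀ x ∈ c.1 ∩ d.1, ∀ v : Submodule.span ℝ (F : Set (Fin (S.dim c) → ℝ)),
        (v : Fin (S.dim c) → ℝ) = S.chart c x →
        (e v : Fin (S.dim d) → ℝ) = S.chart d x

/-- The data of a monoidal complex: a cone system together with a submonoid `M_c` of the ambient
space of `C_c` for each face `c`. -/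
structure MonoidSystem (X : Type*) extends ConeSystem X where
  monoid : (c : faces) → AddSubmonoid (Fin (dim c) → ℝ)

namespace MonoidSystem

variable {X : Type*}

/-- `M.Mem c x` : the point `x` of the face `c` belongs to `M_c` (regarded as a subset of `c`). -/
def Mem (M : MonoidSystem X) (c : M.faces) (x : X) : Prop :=
  x ∈ c.1 ∧ M.chart c x ∈ M.monoid c

/-- The axioms of a monoidal complex (on top of those of its supporting conical complex): each
`M_c` is a finitely generated monoid of integer vectors that generates the cone `C_c`, and
`M_c`, `M_d` restrict to the same subset of `c ∩ d`. (On `c ∩ d` the change of charts is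
additive, being the restriction of a linear map.) -/
structure IsMonoidalComplex (M : MonoidSystem X) : Prop where
  isConicalComplex : M.toConeSystem.IsConicalComplex
  integral : ∀ c, ∀ m ∈ M.monoid c, ∀ i, ∃ k : ℤ, m i = k
  fg : ∀ c, (M.monoid c).FG
  hull_eq : ∀ c, PointedCone.hull ℝ (M.monoid c : Set (Fin (M.dim c) → ℝ)) = M.cone c
  compat : ∀ c d : M.faces, ∀ x ∈ c.1 ∩ d.1, M.Mem c x ↔ M.Mem d x

/-- `|M|`, the set of monomials: the union of the monoids `M_c` inside the support of the complex.
By the compatibility conditions this is the direct limit of the `M_c`. -/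
def Monomials (M : MonoidSystem X) : Type _ :=
  {x : X // ∃ c, M.Mem c x}

/-- The graph of the partial addition of `|M|`: `x = a + b` in some `M_c` that contains `a`
and `b`. -/
def IsSum (M : MonoidSystem X) (a b x : M.Monomials) : Prop :=
  ∃ c, M.Mem c a.1 ∧ M.Mem c b.1 ∧ M.Mem c x.1 ∧
    M.chart c x.1 = M.chart c a.1 + M.chart c b.1

/-- `x` is the zero element of some `M_c`. -/
def IsOrigin (M : MonoidSystem X) (x : M.Monomials) : Prop :=
  ∃ c : M.faces, x.1 ∈ c.1 ∧ M.chart c x.1 = 0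

/-- The exponents `|M| ∪ {-∞}` of the toric face ring; `none` is `-∞`. -/
def Exponents (M : MonoidSystem X) (_ : M.IsMonoidalComplex) : Type _ :=
  Option M.Monomials

/-- An element of `|M| ∪ {-∞}`, regarded as an exponent. -/
def toExponents (M : MonoidSystem X) (hM : M.IsMonoidalComplex) (a : Option M.Monomials) :
    M.Exponents hM := a

section
open Classical in
/-- The addition of exponents, written multiplicatively: `a + b` if `a` and `b` lie in a common
`M_c`, and `-∞` otherwise. -/
noncomputable def expMul (M : MonoidSystem X) :
    Option M.Monomials → Option M.Monomials → Option M.Monomials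
  | some a, some b => if h : ∃ x, M.IsSum a b x then some h.choose else none
  | _, _ => none

open Classical in
/-- The zero element of `|M|` as an exponent (`-∞` if the complex has no faces at all). -/
noncomputable def expOne (M : MonoidSystem X) : Option M.Monomials :=
  if h : ∃ x, M.IsOrigin x then some h.choose else none

end

theorem mem_of_add_mem {M : MonoidSystem X} (hM : M.IsMonoidalComplex) {c d : M.faces}
    {a b x : X} (ha : a ∈ c.1) (hb : b ∈ c.1) (hx : x ∈ c.1) (hxd : x ∈ d.1)
    (h : M.chart c x = M.chart c a + M.chart c b) : a ∈ d.1 ∧ b ∈ d.1 := by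
  obtain ⟨F, G, hF, -, hcF, -, -⟩ := hM.isConicalComplex.inter c d
  have hbij := hM.isConicalComplex.bijOn c
  have hxF : M.chart c x ∈ F := by
    have : x ∈ c.1 ∩ d.1 := ⟨hx, hxd⟩
    rw [hcF] at this
    exact this.2
  rw [h] at hxF
  have h1 := hF.mem_of_add_mem_left (hbij.mapsTo ha) (hbij.mapsTo hb) hxF
  have h2 := hF.mem_of_add_mem_left (hbij.mapsTo hb) (hbij.mapsTo ha) (by rwa [add_comm] at hxF)
  have h3 : a ∈ c.1 ∩ d.1 := by rw [hcF]; exact ⟨ha, h1⟩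
  have h4 : b ∈ c.1 ∩ d.1 := by rw [hcF]; exact ⟨hb, h2⟩
  exact ⟨h3.2, h4.2⟩

theorem chart_add {M : MonoidSystem X} (hM : M.IsMonoidalComplex) {c d : M.faces}
    {a b x : X} (ha : a ∈ c.1 ∩ d.1) (hb : b ∈ c.1 ∩ d.1) (hx : x ∈ c.1)
    (h : M.chart c x = M.chart c a + M.chart c b) :
    x ∈ d.1 ∧ M.chart d x = M.chart d a + M.chart d b := by
  obtain ⟨F, G, hF, hG, hcF, hcG, e, he⟩ := hM.isConicalComplex.inter c d
  have haF : M.chart c a ∈ F := (hcF ▸ ha : a ∈ M.toConeSystem.part c F).2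
  have hbF : M.chart c b ∈ F := (hcF ▸ hb : b ∈ M.toConeSystem.part c F).2
  have hxF : M.chart c x ∈ F := h ▸ F.add_mem haF hbF
  have hx' : x ∈ c.1 ∩ d.1 := by rw [hcF]; exact ⟨hx, hxF⟩
  refine ⟨hx'.2, ?_⟩
  have ea := he a ha ⟨_, Submodule.subset_span haF⟩ rfl
  have eb := he b hb ⟨_, Submodule.subset_span hbF⟩ rfl
  have ex := he x hx' (⟨_, Submodule.subset_span haF⟩ + ⟨_, Submodule.subset_span hbF⟩) h.symm
  rw [← ea, ← eb, ← ex, map_add]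
  rfl

theorem IsSum.mem {M : MonoidSystem X} (hM : M.IsMonoidalComplex) {a b x : M.Monomials}
    (h : M.IsSum a b x) {d : M.faces} (hx : x.1 ∈ d.1) :
    M.Mem d a.1 ∧ M.Mem d b.1 ∧ M.Mem d x.1 ∧
      M.chart d x.1 = M.chart d a.1 + M.chart d b.1 := by
  obtain ⟨c, ha, hb, hx', hs⟩ := h
  obtain ⟨h1, h2⟩ := mem_of_add_mem hM ha.1 hb.1 hx'.1 hx hs
  exact ⟨(hM.compat c d _ ⟨ha.1, h1⟩).1 ha, (hM.compat c d _ ⟨hb.1, h2⟩).1 hb,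
    (hM.compat c d _ ⟨hx'.1, hx⟩).1 hx', (chart_add hM ⟨ha.1, h1⟩ ⟨hb.1, h2⟩ hx'.1 hs).2⟩

theorem IsSum.unique {M : MonoidSystem X} (hM : M.IsMonoidalComplex) {a b x y : M.Monomials}
    (hx : M.IsSum a b x) (hy : M.IsSum a b y) : x = y := by
  obtain ⟨c, ha, hb, hx', hs⟩ := hx
  obtain ⟨d, ha', hb', hy', hs'⟩ := hy
  obtain ⟨h1, h2⟩ := chart_add hM ⟨ha.1, ha'.1⟩ ⟨hb.1, hb'.1⟩ hx'.1 hs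
  exact Subtype.ext ((hM.isConicalComplex.bijOn d).injOn h1 hy'.1 (h2.trans hs'.symm))

theorem exists_isSum {M : MonoidSystem X} (hM : M.IsMonoidalComplex) {c : M.faces}
    {a b : M.Monomials} (ha : M.Mem c a.1) (hb : M.Mem c b.1) :
    ∃ x, M.IsSum a b x ∧ M.Mem c x.1 ∧ M.chart c x.1 = M.chart c a.1 + M.chart c b.1 := by
  have hm := (M.monoid c).add_mem ha.2 hb.2
  have hC : M.chart c a.1 + M.chart c b.1 ∈ M.cone c := by
    rw [← hM.hull_eq c]
    exact PointedCone.subset_hull hm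
  obtain ⟨x, hx, hxs⟩ := (hM.isConicalComplex.bijOn c).surjOn hC
  have hx' : M.Mem c x := ⟨hx, by rw [hxs]; exact hm⟩
  exact ⟨⟨x, c, hx'⟩, ⟨c, ha, hb, hx', hxs⟩, hx', hxs⟩

theorem expMul_eq_some {M : MonoidSystem X} (hM : M.IsMonoidalComplex) {a b x : M.Monomials} :
    M.expMul (some a) (some b) = some x ↔ M.IsSum a b x := by
  simp only [expMul]
  split_ifs with h
  · constructor
    · intro hx
      rw [← Option.some.inj hx]
      exact h.choose_spec
    · intro hx
      exact congrArg some (h.choose_spec.unique hM hx)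
  · constructor
    · intro hx
      simp at hx
    · intro hx
      exact absurd ⟨x, hx⟩ h

theorem IsSum.symm {M : MonoidSystem X} {a b x : M.Monomials}
    (h : M.IsSum a b x) : M.IsSum b a x := by
  obtain ⟨c, ha, hb, hx, hs⟩ := h
  exact ⟨c, hb, ha, hx, by rw [hs, add_comm]⟩

theorem expMul_none_left (M : MonoidSystem X) (a : Option M.Monomials) :
    M.expMul none a = none := by
  unfold expMul; rfl

theorem expMul_none_right (M : MonoidSystem X) (a : Option M.Monomials) :
    M.expMul a none = none := by
  cases a <;> (unfold expMul; rfl)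

theorem expMul_comm {M : MonoidSystem X} (hM : M.IsMonoidalComplex) (a b : Option M.Monomials) :
    M.expMul a b = M.expMul b a := by
  rcases a with _ | a
  · rw [expMul_none_left, expMul_none_right]
  rcases b with _ | b
  · rw [expMul_none_left, expMul_none_right]
  ext x
  rw [expMul_eq_some hM, expMul_eq_some hM]
  exact ⟨IsSum.symm, IsSum.symm⟩

theorem expMul_eq_some' {M : MonoidSystem X} (hM : M.IsMonoidalComplex)
    {a b : Option M.Monomials} {x : M.Monomials} :
    M.expMul a b = some x ↔ ∃ a' b', a = some a' ∧ b = some b' ∧ M.IsSum a' b' x := by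
  rcases a with _ | a
  · simp [expMul_none_left]
  rcases b with _ | b
  · simp [expMul_none_right]
  rw [expMul_eq_some hM]
  constructor
  · intro h
    exact ⟨a, b, rfl, rfl, h⟩
  · rintro ⟨a', b', h1, h2, h⟩
    cases h1
    cases h2
    exact h

theorem expMul_assoc_some {M : MonoidSystem X} (hM : M.IsMonoidalComplex)
    {a b c : Option M.Monomials} {x : M.Monomials}
    (h : M.expMul (M.expMul a b) c = some x) : M.expMul a (M.expMul b c) = some x := by
  obtain ⟨s, c, hs, rfl, hx⟩ := (expMul_eq_some' hM).1 h
  obtain ⟨a, b, rfl, rfl, hab⟩ := (expMul_eq_some' hM).1 hs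
  obtain ⟨f, hsf, hcf, hxf, hf⟩ := hx
  obtain ⟨haf, hbf, -, hsum⟩ := hab.mem hM hsf.1
  obtain ⟨t, ht, htf, hts⟩ := exists_isSum hM hbf hcf
  rw [(expMul_eq_some hM).2 ht, expMul_eq_some hM]
  exact ⟨f, haf, htf, hxf, by rw [hf, hsum, hts, add_assoc]⟩

theorem expMul_assoc {M : MonoidSystem X} (hM : M.IsMonoidalComplex)
    (a b c : Option M.Monomials) :
    M.expMul (M.expMul a b) c = M.expMul a (M.expMul b c) := by
  ext x
  refine ⟨expMul_assoc_some hM, fun h => ?_⟩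
  rw [expMul_comm hM, expMul_comm hM a b]
  apply expMul_assoc_some hM
  rw [expMul_comm hM, expMul_comm hM c b]
  exact h

theorem expOne_mul {M : MonoidSystem X} (hM : M.IsMonoidalComplex) (a : Option M.Monomials) :
    M.expMul M.expOne a = a := by
  rcases a with _ | a
  · rw [expMul_none_right]
  obtain ⟨c, hac⟩ := a.2
  have hex : ∃ x, M.IsOrigin x := by
    obtain ⟨z, hz, hz0⟩ := (hM.isConicalComplex.bijOn c).surjOn (M.cone c).zero_mem
    exact ⟨⟨z, c, hz, by rw [hz0]; exact (M.monoid c).zero_mem⟩, c, hz, hz0⟩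
  unfold expOne
  rw [dif_pos hex, expMul_eq_some hM]
  obtain ⟨d, hd, hd0⟩ := hex.choose_spec
  set z := hex.choose
  obtain ⟨F, G, hF, hG, hcF, hcG, e, he⟩ := hM.isConicalComplex.inter d c
  have hz : z.1 ∈ d.1 ∩ c.1 := by
    rw [hcF]
    exact ⟨hd, by rw [hd0]; exact F.zero_mem⟩
  have hz0 : M.chart c z.1 = 0 := by
    rw [← he z.1 hz 0 (by rw [hd0]; rfl), map_zero]
    rfl
  exact ⟨c, ⟨hz.2, by rw [hz0]; exact (M.monoid c).zero_mem⟩, hac, hac, by rw [hz0, zero_add]⟩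

noncomputable instance (M : MonoidSystem X) (hM : M.IsMonoidalComplex) :
    CommMonoid (M.Exponents hM) where
  mul a b := M.expMul a b
  one := M.expOne
  mul_assoc := expMul_assoc hM
  one_mul := expOne_mul hM
  mul_one a := (expMul_comm hM a M.expOne).trans (expOne_mul hM a)
  mul_comm := expMul_comm hM

section ToricFaceRing

variable (K : Type*) [Field K]

/-- The toric face ring `K[M]`: the monoid algebra of `|M| ∪ {-∞}` modulo the relation
`t^{-∞} = 0`. As `-∞` is absorbing, the `t^a` with `a ∈ |M|` form a `K`-basis of `K[M]`, and
`t^a t^b` is `t^{a+b}` if `a, b` lie in a common `M_c`, and `0` otherwise. -/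
abbrev ToricFaceRing (M : MonoidSystem X) (hM : M.IsMonoidalComplex) : Type _ :=
  MonoidAlgebra K (M.Exponents hM) ⧸
    Ideal.span {MonoidAlgebra.of K (M.Exponents hM) (M.toExponents hM none)}

/-- `t^a ∈ K[M]` for `a ∈ |M| ∪ {-∞}`. -/
noncomputable def toricMonomial (M : MonoidSystem X) (hM : M.IsMonoidalComplex)
    (a : Option M.Monomials) : ToricFaceRing K M hM :=
  Ideal.Quotient.mk _ (MonoidAlgebra.of K (M.Exponents hM) (M.toExponents hM a))

/-- The kernel of `K[X_e : e ∈ E] → K[M]`, `X_e ↦ t^{a_e}`, for a family `a` in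
`|M| ∪ {-∞}`. -/
noncomputable def presentationIdeal {E : Type*} (M : MonoidSystem X) (hM : M.IsMonoidalComplex)
    (a : E → Option M.Monomials) : Ideal (MvPolynomial E K) :=
  RingHom.ker (MvPolynomial.aeval (fun e => toricMonomial K M hM (a e)) :
    MvPolynomial E K →ₐ[K] ToricFaceRing K M hM)

end ToricFaceRing

section Weights

variable {E : Type*}

/-- For each face `c`, those members of the family `(a_e)` that lie in `M_c` generate `M_c`. -/
def Generates (M : MonoidSystem X) (a : E → M.Monomials) : Prop :=
  ∀ c, AddSubmonoid.closure {m | ∃ e, M.Mem c (a e).1 ∧ m = M.chart c (a e).1} = M.monoid c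

/-- The cone `C'_c ⊆ ℝⁿ × ℝ` generated by the `(a_e, w_e)` with `a_e ∈ C_c`. -/
def liftedCone (M : MonoidSystem X) (a : E → M.Monomials) (w : E → ℕ) (c : M.faces) :
    PointedCone ℝ ((Fin (M.dim c) → ℝ) × ℝ) :=
  PointedCone.hull ℝ {p | ∃ e, (a e).1 ∈ c.1 ∧ p = (M.chart c (a e).1, (w e : ℝ))}

/-- The bottom of `C'_c`: its points of least height over each point of `C_c`. -/
def bottom (M : MonoidSystem X) (a : E → M.Monomials) (w : E → ℕ) (c : M.faces) :
    Set ((Fin (M.dim c) → ℝ) × ℝ) :=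
  {p | p ∈ M.liftedCone a w c ∧ ∀ q ∈ M.liftedCone a w c, q.1 = p.1 → p.2 ≤ q.2}

/-- The function `ht_w` on the support of the complex: the least height over `x`, in the lifted
cone of the minimal face that contains `x`. -/
noncomputable def height (M : MonoidSystem X) (a : E → M.Monomials) (w : E → ℕ) (x : X) : ℝ :=
  sInf {h : ℝ | ∃ c : M.faces, Minimal (fun d : M.faces => x ∈ d.1) c ∧
    (M.chart c x, h) ∈ M.liftedCone a w c}

/-- `d ⊆ X` is the image of the cone `D ⊆ C_c`, where `D` is the projection of a face of `C'_c` that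
is contained in the bottom of `C'_c`. -/
def IsBottomPart (M : MonoidSystem X) (a : E → M.Monomials) (w : E → ℕ) (c : M.faces)
    (D : PointedCone ℝ (Fin (M.dim c) → ℝ)) (d : Set X) : Prop :=
  ∃ F : PointedCone ℝ ((Fin (M.dim c) → ℝ) × ℝ),
    F.IsFaceOf (M.liftedCone a w c) ∧ (F : Set _) ⊆ M.bottom a w c ∧
    D = F.map (LinearMap.fst ℝ _ _) ∧ d = M.toConeSystem.part c D

/-- The conical complex `Γ_w`. Its faces are the images in `X` of the projected bottom faces of the
cones `C'_c`, `c ∈ Σ`. To describe `d ∈ Γ_w` as a cone, some `c ∈ Σ` from which it arises is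
chosen, and the chart of `c` is used; another choice gives an isomorphic cone. -/
noncomputable def weightSubdivision (M : MonoidSystem X) (a : E → M.Monomials) (w : E → ℕ) :
    ConeSystem X where
  faces := {d | ∃ c D, M.IsBottomPart a w c D d}
  dim d := M.dim d.2.choose
  cone d := d.2.choose_spec.choose
  chart d := M.chart d.2.choose

/-- `M_w`: on the cone `D_d`, `d ∈ Γ_w`, the monoid `N_{d,w}` generated by all `a_e ∈ D_d` with
`ht_w(a_e) = w_e`. -/
noncomputable def weightComplex (M : MonoidSystem X) (a : E → M.Monomials) (w : E → ℕ) :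
    MonoidSystem X where
  toConeSystem := M.weightSubdivision a w
  monoid d := AddSubmonoid.closure {m | ∃ e, (a e).1 ∈ d.1 ∧ M.height a w (a e).1 = w e ∧
    m = (M.weightSubdivision a w).chart d (a e).1}

open Classical in
/-- The family in `|M_w| ∪ {-∞}` that presents `K[M_w]`: the members `a_e` of the given family
that are used as generators of `M_w`, i.e. those with `ht_w(a_e) = w_e`, and `-∞` in the other
places. -/
noncomputable def weightFamily (M : MonoidSystem X) (a : E → M.Monomials) (w : E → ℕ) (e : E) :
    Option (M.weightComplex a w).Monomials :=
  if h : M.height a w (a e).1 = w e ∧ ∃ d, (M.weightComplex a w).Mem d (a e).1 then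
    some ⟨(a e).1, h.2⟩
  else none

end Weights

end MonoidSystem

/-- The `w`-initial component of a polynomial: its `w`-homogeneous component of highest degree. -/
noncomputable def initialComponent {E K : Type*} [Field K] (w : E → ℕ) (f : MvPolynomial E K) :
    MvPolynomial E K :=
  MvPolynomial.weightedHomogeneousComponent w (MvPolynomial.weightedTotalDegree w f) f

/-- The initial ideal `in_w(I)`. (The linear span of the initial components of the elements of an
ideal is already an ideal.) -/
noncomputable def initialIdeal {E K : Type*} [Field K] (w : E → ℕ)
    (I : Ideal (MvPolynomial E K)) : Ideal (MvPolynomial E K) :=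
  Ideal.span (initialComponent w '' I)

/-!
The lifted cone `C'_c` over a point of `c ∩ d` is the same for `c` and for `d`, since `c ∩ d` is a
face and only generators in that face contribute (`liftedCone_transfer`). So the height is
independent of the face in which it is computed, and a face `F` of `C'_c` inside the bottom is the
graph of the height over its projection. That `M_w` is a monoidal complex follows: if `d` and `d'`
are projections of bottom faces `F` and `F'`, then `d ∩ d'` is a face of `d`, because the lift of a
sum of points of `d` that lies in `d'` is the sum of their lifts, and `F'` is a face
(`IsBottomFace.exists_face_inter`).

For the ideals, a toric face ring embeds into the product of the monoid algebras `K[ℝⁿ]` of the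
ambient spaces of its faces. Hence the kernel of a monomial presentation is the intersection of the
kernels of the homomorphisms `monomialHom`, one for each face (`presentationIdeal_eq_iInf`). Since
`K[ℝⁿ]` is a domain, such an ideal is radical.

* `in_w(I) ⊆ J` (`initialComponent_mem_presentationIdeal`): a monomial with value `z` in `K[M]` has
  weight at least the height of `z`, and if `z` lies below a bottom face `F`, then equality holds
  precisely for the monomials in generators from `F`. So a coefficient of the image of `in_w(f)` in
  `K[M_w]` is either an empty sum or the corresponding coefficient of the image of `f` in `K[M]`.
* `J ⊆ Rad(in_w(I))`: modulo the radical, `f ∈ J` is a combination of monomials that vanish in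
  `K[M_w]` and of differences of monomials in generators from one bottom face with the same value.
  The latter belong to `I` and are `w`-homogeneous (`binomial_mem_initialIdeal`). A monomial `X^u`
  that vanishes in `K[M_w]` either belongs to `I`, or its lift is not in the bottom of some `C'_c`.
  In the second case there is a real combination of generators with the same value and a smaller
  weight. Simultaneous Diophantine approximation makes it integral: for a suitable `N` there is an
  `X^v` of smaller weight than `X^{Nu}` with the same value, the value being exact because it is an
  integer vector (`exists_exponent_of_lt`). Then `X^{Nu}` is the initial component of
  `X^{Nu} - X^v ∈ I`.
-/

/-! ### Cones generated by finite families, and approximation of real combinations -/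

theorem PointedCone.mem_hull_iff_exists_sum {E V : Type*} [Fintype E] [AddCommGroup V]
    [Module ℝ V] (g : E → V) (P : E → Prop) {p : V} :
    p ∈ PointedCone.hull ℝ {q | ∃ e, P e ∧ q = g e} ↔
      ∃ l : E → ℝ, (∀ e, 0 ≤ l e) ∧ (∀ e, l e ≠ 0 → P e) ∧ p = ∑ e, l e • g e := by
  classical
  constructor
  · intro hp
    induction hp using Submodule.span_induction with
    | mem q hq =>
      obtain ⟨e, he, rfl⟩ := hq
      refine ⟨Pi.single e 1, fun f => ?_, fun f hf => ?_, ?_⟩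
      · by_cases h : f = e
        · subst h; simp
        · simp [h]
      · by_cases h : f = e
        · rwa [h]
        · simp [h] at hf
      · simp [Pi.single_apply]
    | zero => exact ⟨0, by simp, by simp, by simp⟩
    | add x y _ _ hx hy =>
      obtain ⟨l, hl, hlP, rfl⟩ := hx
      obtain ⟨k, hk, hkP, rfl⟩ := hy
      refine ⟨l + k, fun e => add_nonneg (hl e) (hk e), fun e he => ?_, ?_⟩
      · by_cases h : l e = 0
        · exact hkP e fun h' => he (by simp [h, h'])
        · exact hlP e h
      · simp [add_smul, Finset.sum_add_distrib]
    | smul r x _ hx =>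
      obtain ⟨l, hl, hlP, rfl⟩ := hx
      refine ⟨fun e => (r : ℝ) * l e, fun e => mul_nonneg r.2 (hl e),
        fun e he => hlP e (right_ne_zero_of_mul he), ?_⟩
      rw [Finset.smul_sum]
      exact Finset.sum_congr rfl fun e _ => (mul_smul (r : ℝ) (l e) (g e)).symm
  · rintro ⟨l, hl, hlP, rfl⟩
    refine Submodule.sum_mem _ fun e _ => ?_
    by_cases h : l e = 0
    · rw [h, zero_smul]
      exact Submodule.zero_mem _
    · exact PointedCone.smul_mem _ (hl e) (PointedCone.subset_hull ⟨e, hlP e h, rfl⟩)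

/-- If a nonnegative combination of points of a cone lies in a face, then so does every point with
a nonzero coefficient. -/
theorem PointedCone.IsFaceOf.mem_of_sum {E V : Type*} [Fintype E] [AddCommGroup V] [Module ℝ V]
    {F C : PointedCone ℝ V} (hF : F.IsFaceOf C) {g : E → V} {l : E → ℝ} (hl : ∀ e, 0 ≤ l e)
    (hg : ∀ e, l e ≠ 0 → g e ∈ C) (h : ∑ e, l e • g e ∈ F) {e : E} (he : l e ≠ 0) :
    g e ∈ F := by
  have h1 : l e • g e ∈ F := by
    refine hF.mem_of_sum_mem (f := fun e => l e • g e) (fun f => ?_) h e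
    by_cases hf : l f = 0
    · simp [hf]
    · exact C.smul_mem (hl f) (hg f hf)
  have h2 := F.smul_mem (inv_nonneg.2 (hl e)) h1
  rwa [smul_smul, inv_mul_cancel₀ he, one_smul] at h2

/-- A sum of points of a cone lies in a face only if the summands do, so that the generators
outside of a face `G` do not matter for the part of a monoid that lies in `G`. -/
theorem PointedCone.IsFaceOf.map_mem_closure {V W : Type*} [AddCommGroup V] [Module ℝ V]
    [AddCommGroup W] [Module ℝ W] {G D : PointedCone ℝ V} (hG : G.IsFaceOf D) (L : V →ₗ[ℝ] W)
    {S : Set V} {T : Set W} (hS : S ⊆ D) (hT : ∀ v ∈ S, v ∈ G → L v ∈ T) {v : V}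
    (hv : v ∈ AddSubmonoid.closure S) (hvG : v ∈ G) : L v ∈ AddSubmonoid.closure T := by
  have hD : AddSubmonoid.closure S ≤ D.toAddSubmonoid := AddSubmonoid.closure_le.2 hS
  induction hv using AddSubmonoid.closure_induction with
  | mem v hv => exact AddSubmonoid.subset_closure (hT v hv hvG)
  | zero => simp
  | add u v hu hv ihu ihv =>
    rw [map_add]
    exact AddSubmonoid.add_mem _ (ihu (hG.mem_of_add_mem_left (hD hu) (hD hv) hvG))
      (ihv (hG.mem_of_add_mem_right (hD hu) (hD hv) hvG))

/-- Simultaneous Diophantine approximation of finitely many nonnegative numbers `l e` by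
fractions `v e / N` whose numerators are natural numbers. -/
theorem exists_nat_simultaneous_approx {E : Type*} [Fintype E] (l : E → ℝ) (hl : ∀ e, 0 ≤ l e)
    {ε : ℝ} (hε : 0 < ε) :
    ∃ (N : ℕ) (v : E → ℕ), 0 < N ∧ (∀ e, |(v e : ℝ) - N * l e| < ε) ∧
      ∀ e, l e = 0 → v e = 0 := by
  -- Two of the points of the unit cube given by the fractional parts of `n * l e` are close.
  let f : ℕ → E → ℝ := fun n e => (n : ℝ) * l e - ⌊(n : ℝ) * l e⌋₊
  have hf : ∀ n, f n ∈ Set.univ.pi fun _ : E => Set.Icc (0 : ℝ) 1 := fun n e _ => by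
    have h0 : 0 ≤ (n : ℝ) * l e := mul_nonneg n.cast_nonneg (hl e)
    have h1 := Nat.floor_le h0
    have h2 := Nat.lt_floor_add_one ((n : ℝ) * l e)
    constructor <;> simp only [f] <;> linarith
  obtain ⟨y, -, φ, hφ, hy⟩ :=
    (isCompact_univ_pi fun _ : E => isCompact_Icc (a := (0 : ℝ)) (b := 1)).tendsto_subseq hf
  obtain ⟨n, hn⟩ := Metric.cauchySeq_iff'.1 hy.cauchySeq ε hε
  have hlt : φ n < φ (n + 1) := hφ n.lt_succ_self
  refine ⟨φ (n + 1) - φ n, fun e => ⌊(φ (n + 1) : ℝ) * l e⌋₊ - ⌊(φ n : ℝ) * l e⌋₊,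
    Nat.sub_pos_of_lt hlt, fun e => ?_, fun e he => by simp [he]⟩
  have h1 := (dist_pi_lt_iff hε).1 (hn (n + 1) n.le_succ) e
  have h2 : ⌊(φ n : ℝ) * l e⌋₊ ≤ ⌊(φ (n + 1) : ℝ) * l e⌋₊ := by
    refine Nat.floor_le_floor (mul_le_mul_of_nonneg_right ?_ (hl e))
    exact_mod_cast hlt.le
  rw [Nat.cast_sub h2, Nat.cast_sub hlt.le]
  rw [Real.dist_eq, ← abs_neg] at h1
  convert h1 using 2
  simp only [f, Function.comp]
  ring

/-! ### Changes of charts -/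

/-- The changes of charts of a conical complex are induced by linear maps of the ambient spaces. -/
theorem ConeSystem.IsConicalComplex.exists_transition {X : Type*} {S : ConeSystem X}
    (hS : S.IsConicalComplex) (c d : S.faces) :
    ∃ (A : PointedCone ℝ (Fin (S.dim c) → ℝ))
      (L : (Fin (S.dim c) → ℝ) →ₗ[ℝ] (Fin (S.dim d) → ℝ)),
      A.IsFaceOf (S.cone c) ∧ c.1 ∩ d.1 = S.part c A ∧
      ∀ x ∈ c.1, x ∈ d.1 → L (S.chart c x) = S.chart d x := by
  obtain ⟨A, B, hA, -, hcA, -, e, he⟩ := hS.inter c d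
  obtain ⟨L, hL⟩ := LinearMap.exists_extend ((Submodule.subtype _).comp e.toLinearMap)
  refine ⟨A, L, hA, hcA, fun x hx hxd => ?_⟩
  have hxA : S.chart c x ∈ A := (hcA ▸ ⟨hx, hxd⟩ : x ∈ S.part c A).2
  rw [← he x ⟨hx, hxd⟩ ⟨_, Submodule.subset_span hxA⟩ rfl]
  exact LinearMap.congr_fun hL ⟨_, Submodule.subset_span hxA⟩

/-- Linear maps in both directions that restrict to mutually inverse bijections between two sets
restrict to an isomorphism between the linear spans. -/
theorem LinearMap.exists_equiv_span {V W : Type*} [AddCommGroup V] [Module ℝ V] [AddCommGroup W]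
    [Module ℝ W] {G : Set V} {H : Set W} (L : V →ₗ[ℝ] W) (L' : W →ₗ[ℝ] V)
    (hL : ∀ v ∈ G, L v ∈ H) (hL' : ∀ v ∈ H, L' v ∈ G) (hLL : ∀ v ∈ G, L' (L v) = v)
    (hLL' : ∀ v ∈ H, L (L' v) = v) :
    ∃ e : Submodule.span ℝ G ≃ₗ[ℝ] Submodule.span ℝ H, ∀ v, (e v : W) = L v := by
  have h1 : ∀ v ∈ Submodule.span ℝ G, L v ∈ Submodule.span ℝ H := fun v hv =>
    (Submodule.span_le.2 fun u hu => Submodule.subset_span (hL u hu) :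
      Submodule.span ℝ G ≤ (Submodule.span ℝ H).comap L) hv
  have h2 : ∀ v ∈ Submodule.span ℝ H, L' v ∈ Submodule.span ℝ G := fun v hv =>
    (Submodule.span_le.2 fun u hu => Submodule.subset_span (hL' u hu) :
      Submodule.span ℝ H ≤ (Submodule.span ℝ G).comap L') hv
  have h3 : ∀ v ∈ Submodule.span ℝ G, L' (L v) = v := fun v hv =>
    LinearMap.eqOn_span (f := L'.comp L) (g := LinearMap.id) hLL hv
  have h4 : ∀ v ∈ Submodule.span ℝ H, L (L' v) = v := fun v hv =>
    LinearMap.eqOn_span (f := L.comp L') (g := LinearMap.id) hLL' hv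
  exact ⟨LinearEquiv.ofLinearMap (L.restrict h1) (L'.restrict h2)
    (LinearMap.ext fun v => Subtype.ext (h4 v v.2))
    (LinearMap.ext fun v => Subtype.ext (h3 v v.2)), fun v => rfl⟩

namespace MonoidSystem

variable {X E : Type*} {M : MonoidSystem X} {a : E → M.Monomials} {w : E → ℕ}

theorem mem_monomial_iff (hM : M.IsMonoidalComplex) (x : M.Monomials) (c : M.faces) :
    M.Mem c x.1 ↔ x.1 ∈ c.1 := by
  refine ⟨fun h => h.1, fun h => ?_⟩
  obtain ⟨d, hd⟩ := x.2
  exact (hM.compat d c _ ⟨hd.1, h⟩).1 hd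

/-! ### The lifted cones and the height function -/

/-- The generator `(a_e, w_e)` of the lifted cones, in the chart of `c`. -/
def liftedGenerator (M : MonoidSystem X) (a : E → M.Monomials) (w : E → ℕ) (c : M.faces) (e : E) :
    (Fin (M.dim c) → ℝ) × ℝ :=
  (M.chart c (a e).1, (w e : ℝ))

theorem mem_liftedCone [Fintype E] {c : M.faces} {p : (Fin (M.dim c) → ℝ) × ℝ} :
    p ∈ M.liftedCone a w c ↔ ∃ l : E → ℝ, (∀ e, 0 ≤ l e) ∧ (∀ e, l e ≠ 0 → (a e).1 ∈ c.1) ∧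
      p = ∑ e, l e • M.liftedGenerator a w c e :=
  PointedCone.mem_hull_iff_exists_sum (M.liftedGenerator a w c) (fun e => (a e).1 ∈ c.1)

theorem liftedGenerator_mem {c : M.faces} {e : E} (he : (a e).1 ∈ c.1) :
    M.liftedGenerator a w c e ∈ M.liftedCone a w c :=
  PointedCone.subset_hull ⟨e, he, rfl⟩

theorem sum_smul_liftedGenerator [Fintype E] {c : M.faces} (l : E → ℝ) :
    ∑ e, l e • M.liftedGenerator a w c e =
      (∑ e, l e • M.chart c (a e).1, ∑ e, l e * w e) := by
  ext1 <;> simp [liftedGenerator, Prod.fst_sum, Prod.snd_sum]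

theorem fst_mem_cone (hM : M.IsMonoidalComplex) {c : M.faces} {p : (Fin (M.dim c) → ℝ) × ℝ}
    (hp : p ∈ M.liftedCone a w c) : p.1 ∈ M.cone c := by
  have h : M.liftedCone a w c ≤ PointedCone.comap (LinearMap.fst ℝ _ _) (M.cone c) := by
    refine Submodule.span_le.2 ?_
    rintro _ ⟨e, he, rfl⟩
    exact (hM.isConicalComplex.bijOn c).mapsTo he
  exact h hp

theorem snd_nonneg [Fintype E] {c : M.faces} {p : (Fin (M.dim c) → ℝ) × ℝ}
    (hp : p ∈ M.liftedCone a w c) : 0 ≤ p.2 := by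
  obtain ⟨l, hl, -, rfl⟩ := mem_liftedCone.1 hp
  rw [sum_smul_liftedGenerator]
  exact Finset.sum_nonneg fun e _ => mul_nonneg (hl e) (w e).cast_nonneg

/-- The part of the lifted cone over a point of `c ∩ d` is the same for `c` and for `d`: as `c ∩ d`
is a face, only the generators in `c ∩ d` contribute to it. -/
theorem liftedCone_transfer [Fintype E] (hM : M.IsMonoidalComplex) {c d : M.faces} {x : X}
    (hxc : x ∈ c.1) (hxd : x ∈ d.1) {h : ℝ} (hx : (M.chart c x, h) ∈ M.liftedCone a w c) :
    (M.chart d x, h) ∈ M.liftedCone a w d := by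
  obtain ⟨A, L, hA, hcA, hL⟩ := hM.isConicalComplex.exists_transition c d
  obtain ⟨l, hl, hlc, hs⟩ := mem_liftedCone.1 hx
  rw [sum_smul_liftedGenerator, Prod.mk.injEq] at hs
  have hxA : M.chart c x ∈ A := (hcA ▸ ⟨hxc, hxd⟩ : x ∈ M.toConeSystem.part c A).2
  have hmem : ∀ e, l e ≠ 0 → (a e).1 ∈ c.1 ∩ d.1 := fun e he => by
    rw [hcA]
    exact ⟨hlc e he, hA.mem_of_sum hl
      (fun f hf => (hM.isConicalComplex.bijOn c).mapsTo (hlc f hf)) (hs.1 ▸ hxA) he⟩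
  refine mem_liftedCone.2 ⟨l, hl, fun e he => (hmem e he).2, ?_⟩
  rw [sum_smul_liftedGenerator, ← hL x hxc hxd, hs.1, ← hs.2, map_sum]
  congr 1
  refine Finset.sum_congr rfl fun e _ => ?_
  by_cases he : l e = 0
  · simp [he]
  · rw [map_smul, hL _ (hmem e he).1 (hmem e he).2]

/-- The height of a point can be computed in any face that contains it. -/
theorem height_eq [Fintype E] (hM : M.IsMonoidalComplex) {c : M.faces} {x : X} (hx : x ∈ c.1) :
    M.height a w x = sInf {h : ℝ | (M.chart c x, h) ∈ M.liftedCone a w c} := by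
  have : Finite M.faces := hM.isConicalComplex.finite
  obtain ⟨d, hd⟩ := exists_minimal_of_wellFoundedLT (fun d : M.faces => x ∈ d.1) ⟨c, hx⟩
  unfold height
  congr 1
  ext h
  exact ⟨fun ⟨d, hd, hh⟩ => liftedCone_transfer hM hd.1 hx hh,
    fun hh => ⟨d, hd, liftedCone_transfer hM hx hd.1 hh⟩⟩

theorem height_of_mem_bottom [Fintype E] (hM : M.IsMonoidalComplex) {c : M.faces} {x : X}
    (hx : x ∈ c.1) {h : ℝ} (hh : (M.chart c x, h) ∈ M.bottom a w c) : M.height a w x = h := by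
  rw [height_eq hM hx]
  exact IsLeast.csInf_eq ⟨hh.1, fun k hk => hh.2 _ hk rfl⟩

/-- Every point of the bottom lies in a face of the lifted cone that is contained in the bottom,
namely in the smallest face that contains the point. -/
theorem exists_face_subset_bottom {c : M.faces} {p : (Fin (M.dim c) → ℝ) × ℝ}
    (hp : p ∈ M.bottom a w c) :
    ∃ F : PointedCone ℝ ((Fin (M.dim c) → ℝ) × ℝ), F.IsFaceOf (M.liftedCone a w c) ∧
      (F : Set _) ⊆ M.bottom a w c ∧ p ∈ F := by
  set C := M.liftedCone a w c with hC
  let F : PointedCone ℝ ((Fin (M.dim c) → ℝ) × ℝ) :=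
    { carrier := {q | q ∈ C ∧ ∃ t : ℝ, 0 < t ∧ t • p - q ∈ C}
      zero_mem' := ⟨C.zero_mem, 1, one_pos, by simpa using hp.1⟩
      add_mem' := by
        rintro q r ⟨hq, s, hs, hsq⟩ ⟨hr, t, ht, htr⟩
        refine ⟨C.add_mem hq hr, s + t, add_pos hs ht, ?_⟩
        convert C.add_mem hsq htr using 1
        rw [add_smul]
        abel
      smul_mem' := by
        rintro k q ⟨hq, s, hs, hsq⟩
        refine ⟨C.smul_mem k.2 hq, k * s + 1, by have := k.2; positivity, ?_⟩
        convert C.add_mem (C.smul_mem k.2 hsq) hp.1 using 1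
        rw [add_smul, one_smul, smul_sub, smul_smul]
        exact add_sub_right_comm _ _ _ }
  refine ⟨F, ⟨fun q hq => hq.1, ?_⟩, ?_, hp.1, 1, one_pos, by simp⟩
  · rintro q r k hq hr hk ⟨-, s, hs, h⟩
    refine ⟨hq, k⁻¹ * s, by positivity, ?_⟩
    convert C.smul_mem (inv_pos.2 hk).le (C.add_mem h hr) using 1
    rw [sub_add_eq_sub_sub, sub_add_cancel, smul_sub, smul_smul, smul_smul,
      inv_mul_cancel₀ hk.ne', one_smul]
  · rintro q ⟨hq, t, ht, htq⟩
    refine ⟨hq, fun r hr hrq => ?_⟩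
    have h1 := C.smul_mem (inv_pos.2 ht).le (C.add_mem htq hr)
    have h2 := hp.2 _ h1 (by
      simp only [Prod.smul_fst, Prod.fst_add, Prod.fst_sub, hrq, sub_add_cancel, smul_smul,
        inv_mul_cancel₀ ht.ne', one_smul])
    simp only [Prod.smul_snd, Prod.snd_add, Prod.snd_sub, smul_eq_mul] at h2
    rw [← mul_le_mul_iff_right₀ ht, mul_inv_cancel_left₀ ht.ne'] at h2
    linarith

/-! ### Faces of the regular subdivision -/

/-- `d` is the image in `X` of the projection of the face `F` of `C'_c`, and `F` is contained in the
bottom. In contrast to `IsBottomPart`, the face `F` is part of the data. -/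
structure IsBottomFace (M : MonoidSystem X) (a : E → M.Monomials) (w : E → ℕ) (c : M.faces)
    (F : PointedCone ℝ ((Fin (M.dim c) → ℝ) × ℝ)) (d : Set X) : Prop where
  isFaceOf : F.IsFaceOf (M.liftedCone a w c)
  subset_bottom : (F : Set _) ⊆ M.bottom a w c
  eq_part : d = M.toConeSystem.part c (F.map (LinearMap.fst ℝ _ _))

namespace IsBottomFace

variable {c c' : M.faces} {F : PointedCone ℝ ((Fin (M.dim c) → ℝ) × ℝ)}
  {F' : PointedCone ℝ ((Fin (M.dim c') → ℝ) × ℝ)} {d d' : Set X}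

theorem subset (hF : M.IsBottomFace a w c F d) : d ⊆ c.1 := by
  rw [hF.eq_part]
  exact fun x hx => hx.1

/-- A bottom face is the graph of the height function. -/
theorem mem_iff [Fintype E] (hM : M.IsMonoidalComplex) (hF : M.IsBottomFace a w c F d) {x : X} :
    x ∈ d ↔ x ∈ c.1 ∧ (M.chart c x, M.height a w x) ∈ F := by
  rw [hF.eq_part]
  constructor
  · rintro ⟨hx, ⟨v, h⟩, hv, rfl : v = M.chart c x⟩
    refine ⟨hx, ?_⟩
    rwa [height_of_mem_bottom hM hx (hF.subset_bottom hv)]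
  · exact fun h => ⟨h.1, _, h.2, rfl⟩

theorem mem_of_mem [Fintype E] (hM : M.IsMonoidalComplex) (hF : M.IsBottomFace a w c F d) {x : X}
    (hx : x ∈ c.1) {h : ℝ} (hh : (M.chart c x, h) ∈ F) : x ∈ d ∧ M.height a w x = h := by
  have hht := height_of_mem_bottom hM hx (hF.subset_bottom hh)
  exact ⟨(hF.mem_iff hM).2 ⟨hx, hht ▸ hh⟩, hht⟩

/-- A bottom face contains the lifted generators `(a_e, w_e)` for which `a_e` lies in its projection
and `w_e` is the height of `a_e`. -/
theorem liftedGenerator_mem_iff [Fintype E] (hM : M.IsMonoidalComplex)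
    (hF : M.IsBottomFace a w c F d) {e : E} (he : (a e).1 ∈ c.1) :
    M.liftedGenerator a w c e ∈ F ↔ (a e).1 ∈ d ∧ M.height a w (a e).1 = w e := by
  refine ⟨fun h => hF.mem_of_mem hM he h, fun h => ?_⟩
  have := ((hF.mem_iff hM).1 h.1).2
  rwa [h.2] at this

theorem exists_chart_eq (hM : M.IsMonoidalComplex) (hF : M.IsBottomFace a w c F d)
    {v : Fin (M.dim c) → ℝ} (hv : v ∈ F.map (LinearMap.fst ℝ _ _)) :
    ∃ x ∈ d, M.chart c x = v := by
  obtain ⟨p, hp, rfl⟩ := hv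
  obtain ⟨x, hx, hxp⟩ :=
    (hM.isConicalComplex.bijOn c).surjOn (fst_mem_cone hM (hF.isFaceOf.le hp))
  refine ⟨x, ?_, hxp⟩
  rw [hF.eq_part]
  exact ⟨hx, p, hp, hxp.symm⟩

theorem chart_mem (hF : M.IsBottomFace a w c F d) {x : X} (hx : x ∈ d) :
    M.chart c x ∈ F.map (LinearMap.fst ℝ _ _) := by
  rw [hF.eq_part] at hx
  exact hx.2

theorem bijOn (hM : M.IsMonoidalComplex) (hF : M.IsBottomFace a w c F d) :
    Set.BijOn (M.chart c) d (F.map (LinearMap.fst ℝ _ _)) :=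
  ⟨fun _ hx => hF.chart_mem hx, (hM.isConicalComplex.bijOn c).injOn.mono hF.subset,
    fun _ hv => hF.exists_chart_eq hM hv⟩

/-- The height function is linear on the projection of a bottom face. -/
theorem height_add_smul [Fintype E] (hM : M.IsMonoidalComplex) (hF : M.IsBottomFace a w c F d)
    {x y z : X} (hx : x ∈ d) (hy : y ∈ d) (hz : z ∈ c.1) {s : ℝ} (hs : 0 ≤ s)
    (h : M.chart c z = s • M.chart c x + M.chart c y) :
    z ∈ d ∧ M.height a w z = s * M.height a w x + M.height a w y := by
  refine hF.mem_of_mem hM hz ?_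
  rw [h]
  exact F.add_mem (F.smul_mem hs ((hF.mem_iff hM).1 hx).2) ((hF.mem_iff hM).1 hy).2

/-- The intersection of two projected bottom faces is a face of each of them. -/
theorem exists_face_inter [Fintype E] (hM : M.IsMonoidalComplex) (hF : M.IsBottomFace a w c F d)
    (hF' : M.IsBottomFace a w c' F' d') :
    ∃ G : PointedCone ℝ (Fin (M.dim c) → ℝ), G.IsFaceOf (F.map (LinearMap.fst ℝ _ _)) ∧
      (G : Set _) = M.chart c '' (d ∩ d') := by
  obtain ⟨A, L, hA, hcA, hL⟩ := hM.isConicalComplex.exists_transition c c'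
  have hmemA : ∀ x ∈ c.1, x ∈ c'.1 → M.chart c x ∈ A := fun x hx hx' =>
    (hcA ▸ ⟨hx, hx'⟩ : x ∈ M.toConeSystem.part c A).2
  have hA' : ∀ x ∈ c.1, M.chart c x ∈ A → x ∈ c'.1 := fun x hx hx' =>
    (hcA ▸ ⟨hx, hx'⟩ : x ∈ c.1 ∩ c'.1).2
  -- The intersection is closed under nonnegative combinations.
  have key : ∀ x ∈ d ∩ d', ∀ y ∈ d ∩ d', ∀ s : ℝ, 0 ≤ s →
      s • M.chart c x + M.chart c y ∈ M.chart c '' (d ∩ d') := by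
    intro x hx y hy s hs
    obtain ⟨z, hz, hzs⟩ := hF.exists_chart_eq hM (Submodule.add_mem _
      (PointedCone.smul_mem _ hs (hF.chart_mem hx.1)) (hF.chart_mem hy.1))
    have hxA := hmemA x (hF.subset hx.1) (hF'.subset hx.2)
    have hyA := hmemA y (hF.subset hy.1) (hF'.subset hy.2)
    have hzc' : z ∈ c'.1 :=
      hA' z (hF.subset hz) (hzs ▸ A.add_mem (A.smul_mem hs hxA) hyA)
    refine ⟨z, ⟨hz, (hF'.height_add_smul hM hx.2 hy.2 hzc' hs ?_).1⟩, hzs⟩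
    rw [← hL z (hF.subset hz) hzc', hzs, map_add, map_smul,
      hL x (hF.subset hx.1) (hF'.subset hx.2), hL y (hF.subset hy.1) (hF'.subset hy.2)]
  have hzero : (0 : Fin (M.dim c) → ℝ) ∈ M.chart c '' (d ∩ d') := by
    obtain ⟨z, hz, hz0⟩ := hF.exists_chart_eq hM (Submodule.zero_mem _)
    have hzc' : z ∈ c'.1 := hA' z (hF.subset hz) (hz0 ▸ A.zero_mem)
    obtain ⟨y, hy, hy0⟩ := hF'.exists_chart_eq hM (Submodule.zero_mem _)
    have : z = y := by
      refine (hM.isConicalComplex.bijOn c').injOn hzc' (hF'.subset hy) ?_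
      rw [hy0, ← hL z (hF.subset hz) hzc', hz0, map_zero]
    exact ⟨z, ⟨hz, this ▸ hy⟩, hz0⟩
  obtain ⟨o, ho, ho0⟩ := id hzero
  let G : PointedCone ℝ (Fin (M.dim c) → ℝ) :=
    { carrier := M.chart c '' (d ∩ d')
      zero_mem' := hzero
      add_mem' := by
        rintro _ _ ⟨x, hx, rfl⟩ ⟨y, hy, rfl⟩
        simpa using key x hx y hy 1 zero_le_one
      smul_mem' := by
        rintro k _ ⟨x, hx, rfl⟩
        have := key x hx o ho k k.2
        rwa [ho0, add_zero] at this }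
  refine ⟨G, ⟨?_, ?_⟩, rfl⟩
  · rintro _ ⟨x, hx, rfl⟩
    exact hF.chart_mem hx.1
  · rintro u v s hu hv hs ⟨z, hz, hzs⟩
    obtain ⟨x, hx, rfl⟩ := hF.exists_chart_eq hM hu
    obtain ⟨y, hy, rfl⟩ := hF.exists_chart_eq hM hv
    have hbij := hM.isConicalComplex.bijOn c
    have hzA : s • M.chart c x + M.chart c y ∈ A :=
      hzs ▸ hmemA z (hF.subset hz.1) (hF'.subset hz.2)
    have hxc' : x ∈ c'.1 := hA' x (hF.subset hx) (hA.mem_of_smul_add_mem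
      (hbij.mapsTo (hF.subset hx)) (hbij.mapsTo (hF.subset hy)) hs hzA)
    have hyc' : y ∈ c'.1 := hA' y (hF.subset hy) (hA.mem_of_add_mem_right
      (PointedCone.smul_mem _ hs.le (hbij.mapsTo (hF.subset hx)))
      (hbij.mapsTo (hF.subset hy)) hzA)
    refine ⟨x, ⟨hx, (hF'.mem_iff hM).2 ⟨hxc', ?_⟩⟩, rfl⟩
    -- The lift of `z` is a combination of the lifts of `x` and `y`, and `F'` is a face.
    refine hF'.isFaceOf.mem_of_smul_add_mem (a := s)
      (y := (M.chart c' y, M.height a w y)) ?_ ?_ hs ?_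
    · exact liftedCone_transfer hM (hF.subset hx) hxc'
        (hF.isFaceOf.le ((hF.mem_iff hM).1 hx).2)
    · exact liftedCone_transfer hM (hF.subset hy) hyc'
        (hF.isFaceOf.le ((hF.mem_iff hM).1 hy).2)
    · have h1 := ((hF'.mem_iff hM).1 hz.2).2
      rw [(hF.height_add_smul hM hx hy (hF.subset hz.1) hs.le hzs).2,
        ← hL z (hF.subset hz.1) (hF'.subset hz.2), hzs, map_add, map_smul,
        hL x (hF.subset hx) hxc', hL y (hF.subset hy) hyc'] at h1
      exact h1

end IsBottomFace

theorem liftedCone_face_eq_hull [Fintype E] {c : M.faces}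
    {F : PointedCone ℝ ((Fin (M.dim c) → ℝ) × ℝ)} (hF : F.IsFaceOf (M.liftedCone a w c)) :
    F = PointedCone.hull ℝ {q | ∃ e, ((a e).1 ∈ c.1 ∧ M.liftedGenerator a w c e ∈ F) ∧
      q = M.liftedGenerator a w c e} := by
  apply le_antisymm
  · intro p hp
    obtain ⟨l, hl, hlc, rfl⟩ := mem_liftedCone.1 (hF.le hp)
    exact (PointedCone.mem_hull_iff_exists_sum _
      fun e => (a e).1 ∈ c.1 ∧ M.liftedGenerator a w c e ∈ F).2
      ⟨l, hl, fun e he => ⟨hlc e he,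
        hF.mem_of_sum hl (fun f hf => liftedGenerator_mem (hlc f hf)) hp he⟩, rfl⟩
  · refine Submodule.span_le.2 ?_
    rintro _ ⟨e, he, rfl⟩
    exact he.2

/-! ### The regular subdivision as a monoidal complex -/

theorem exists_isBottomFace (d : (M.weightSubdivision a w).faces) :
    ∃ F, M.IsBottomFace a w d.2.choose F d.1 ∧
      (M.weightSubdivision a w).cone d = F.map (LinearMap.fst ℝ _ _) := by
  obtain ⟨F, h1, h2, h3, h4⟩ := d.2.choose_spec.choose_spec
  exact ⟨F, ⟨h1, h2, h3 ▸ h4⟩, h3⟩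

theorem IsBottomFace.mem_faces {c : M.faces} {F : PointedCone ℝ ((Fin (M.dim c) → ℝ) × ℝ)}
    {d : Set X} (hF : M.IsBottomFace a w c F d) : d ∈ (M.weightSubdivision a w).faces :=
  ⟨c, _, F, hF.isFaceOf, hF.subset_bottom, rfl, hF.eq_part⟩

/-- The lifted cones have finitely many faces, as each face is generated by some of the finitely
many generators. -/
theorem weightSubdivision_finite [Fintype E] (hM : M.IsMonoidalComplex) :
    (M.weightSubdivision a w).faces.Finite := by
  have : Finite M.faces := hM.isConicalComplex.finite
  refine (Set.finite_range fun p : M.faces × Set E => M.toConeSystem.part p.1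
    ((PointedCone.hull ℝ {q | ∃ e, e ∈ p.2 ∧ q = M.liftedGenerator a w p.1 e}).map
      (LinearMap.fst ℝ _ _))).subset ?_
  rintro _ ⟨c, _, F, hF, -, rfl, rfl⟩
  refine ⟨(c, {e | (a e).1 ∈ c.1 ∧ M.liftedGenerator a w c e ∈ F}), ?_⟩
  conv_rhs => rw [liftedCone_face_eq_hull hF]
  rfl

theorem weightSubdivision_isConicalComplex [Fintype E] (hM : M.IsMonoidalComplex) :
    (M.weightSubdivision a w).IsConicalComplex where
  finite := weightSubdivision_finite hM
  fg d := by
    obtain ⟨F, hF, hD⟩ := exists_isBottomFace d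
    rw [hD, liftedCone_face_eq_hull hF.isFaceOf]
    refine Submodule.FG.map _ (Submodule.fg_span ?_)
    refine (Set.finite_range (M.liftedGenerator a w d.2.choose)).subset ?_
    rintro _ ⟨e, -, rfl⟩
    exact ⟨e, rfl⟩
  bijOn d := by
    obtain ⟨F, hF, hD⟩ := exists_isBottomFace d
    rw [hD]
    exact hF.bijOn hM
  face_mem d G hG := by
    obtain ⟨F, hF, hD⟩ := exists_isBottomFace d
    rw [hD] at hG
    -- The part of `F` over `G` is a face of `F`, hence of the lifted cone.
    have hF' : (F ⊓ G.comap (LinearMap.fst ℝ _ _)).IsFaceOf F := by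
      refine ⟨inf_le_left, fun {p q s} hp hq hs h => ⟨hp, ?_⟩⟩
      exact hG.mem_of_smul_add_mem ⟨p, hp, rfl⟩ ⟨q, hq, rfl⟩ hs h.2
    refine IsBottomFace.mem_faces (c := d.2.choose) ⟨hF'.trans hF.isFaceOf,
      fun p hp => hF.subset_bottom hp.1, Set.ext fun x => ?_⟩
    constructor
    · rintro ⟨hx, hxG⟩
      exact ⟨hF.subset hx, _, ⟨((hF.mem_iff hM).1 hx).2, hxG⟩, rfl⟩
    · rintro ⟨hx, ⟨v, h⟩, ⟨hF, hG⟩, rfl : v = _⟩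
      exact ⟨(IsBottomFace.mem_of_mem hM ‹_› hx hF).1, hG⟩
  inter d d' := by
    obtain ⟨F, hF, hD⟩ := exists_isBottomFace d
    obtain ⟨F', hF', hD'⟩ := exists_isBottomFace d'
    obtain ⟨G, hG, hGd⟩ := hF.exists_face_inter hM hF'
    obtain ⟨G', hG', hGd'⟩ := hF'.exists_face_inter hM hF
    obtain ⟨-, L, -, -, hL⟩ := hM.isConicalComplex.exists_transition d.2.choose d'.2.choose
    obtain ⟨-, L', -, -, hL'⟩ := hM.isConicalComplex.exists_transition d'.2.choose d.2.choose
    rw [Set.inter_comm] at hGd'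
    have hLG : ∀ x ∈ d.1 ∩ d'.1, L (M.chart d.2.choose x) = M.chart d'.2.choose x :=
      fun x hx => hL x (hF.subset hx.1) (hF'.subset hx.2)
    have hLG' : ∀ x ∈ d.1 ∩ d'.1, L' (M.chart d'.2.choose x) = M.chart d.2.choose x :=
      fun x hx => hL' x (hF'.subset hx.2) (hF.subset hx.1)
    obtain ⟨e, he⟩ := LinearMap.exists_equiv_span (G := (G : Set _)) (H := (G' : Set _)) L L'
      (by rw [hGd, hGd']; rintro _ ⟨x, hx, rfl⟩; exact ⟨x, hx, (hLG x hx).symm⟩)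
      (by rw [hGd, hGd']; rintro _ ⟨x, hx, rfl⟩; exact ⟨x, hx, (hLG' x hx).symm⟩)
      (by rw [hGd]; rintro _ ⟨x, hx, rfl⟩; rw [hLG x hx, hLG' x hx])
      (by rw [hGd']; rintro _ ⟨x, hx, rfl⟩; rw [hLG' x hx, hLG x hx])
    refine ⟨G, G', hD ▸ hG, hD' ▸ hG', Set.ext fun x => ?_, Set.ext fun x => ?_, e,
      fun x hx v hv => (he v).trans ((congrArg L hv).trans (hLG x hx))⟩
    · refine ⟨fun hx => ⟨hx.1, hGd.superset ⟨x, hx, rfl⟩⟩, fun ⟨hx, hxG⟩ => ?_⟩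
      obtain ⟨y, hy, hyx⟩ := hGd.subset hxG
      rwa [← (hF.bijOn hM).injOn hy.1 hx hyx]
    · refine ⟨fun hx => ⟨hx.2, hGd'.superset ⟨x, hx, rfl⟩⟩, fun ⟨hx, hxG⟩ => ?_⟩
      obtain ⟨y, hy, hyx⟩ := hGd'.subset hxG
      rwa [← (hF'.bijOn hM).injOn hy.2 hx hyx]

theorem weightComplex_monoid_le (d : (M.weightComplex a w).faces) :
    ∀ v ∈ (M.weightComplex a w).monoid d, v ∈ (M.weightComplex a w).cone d := by
  obtain ⟨F, hF, hD⟩ := exists_isBottomFace d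
  have h : (M.weightComplex a w).monoid d ≤
      (F.map (LinearMap.fst ℝ _ _)).toAddSubmonoid := by
    refine AddSubmonoid.closure_le.2 ?_
    rintro _ ⟨e, he, -, rfl⟩
    exact hF.chart_mem he
  intro v hv
  have := h hv
  rwa [← hD] at this

/-- On `d ∩ d'` the monoids `N_{d,w}` and `N_{d',w}` agree: as `d ∩ d'` is a face of `d`, a sum of
generators of `N_{d,w}` can only lie in `d ∩ d'` if the generators do. -/
theorem weightComplex_mem_of_mem [Fintype E] (hM : M.IsMonoidalComplex)
    (d d' : (M.weightComplex a w).faces) {x : X} (hx : x ∈ d.1) (hx' : x ∈ d'.1)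
    (h : (M.weightComplex a w).Mem d x) : (M.weightComplex a w).Mem d' x := by
  obtain ⟨F, hF, hD⟩ := exists_isBottomFace d
  obtain ⟨F', hF', -⟩ := exists_isBottomFace d'
  obtain ⟨G, hG, hGd⟩ := hF.exists_face_inter hM hF'
  obtain ⟨-, L, -, -, hL⟩ := hM.isConicalComplex.exists_transition d.2.choose d'.2.choose
  have hS : {m | ∃ e, (a e).1 ∈ d.1 ∧ M.height a w (a e).1 = w e ∧
      m = M.chart d.2.choose (a e).1} ⊆ F.map (LinearMap.fst ℝ _ _) := by
    rintro _ ⟨e, he, -, rfl⟩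
    exact hF.chart_mem he
  have hT : ∀ m ∈ {m | ∃ e, (a e).1 ∈ d.1 ∧ M.height a w (a e).1 = w e ∧
      m = M.chart d.2.choose (a e).1}, m ∈ G →
      L m ∈ {m | ∃ e, (a e).1 ∈ d'.1 ∧ M.height a w (a e).1 = w e ∧
        m = M.chart d'.2.choose (a e).1} := by
    rintro _ ⟨e, he, hew, rfl⟩ heG
    obtain ⟨y, hy, hye⟩ := hGd.subset heG
    obtain rfl := (hF.bijOn hM).injOn hy.1 he hye
    exact ⟨e, hy.2, hew, hL _ (hF.subset hy.1) (hF'.subset hy.2)⟩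
  refine ⟨hx', ?_⟩
  have := hG.map_mem_closure L hS hT h.2 (hGd.superset ⟨x, ⟨hx, hx'⟩, rfl⟩)
  exact (hL x (hF.subset hx) (hF'.subset hx')) ▸ this

theorem weightComplex_hull_eq [Fintype E] (hM : M.IsMonoidalComplex)
    (d : (M.weightComplex a w).faces) :
    PointedCone.hull ℝ ((M.weightComplex a w).monoid d : Set _) =
      (M.weightComplex a w).cone d := by
  obtain ⟨F, hF, hD⟩ := exists_isBottomFace d
  refine le_antisymm (Submodule.span_le.2 (weightComplex_monoid_le d)) ?_
  change (M.weightSubdivision a w).cone d ≤ _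
  rw [hD]
  rintro _ ⟨p, hp, rfl⟩
  rw [liftedCone_face_eq_hull hF.isFaceOf] at hp
  refine (Submodule.span_le.2 ?_ : PointedCone.hull ℝ _ ≤
    PointedCone.comap (LinearMap.fst ℝ _ _) (PointedCone.hull ℝ _)) hp
  rintro _ ⟨e, ⟨hec, heF⟩, rfl⟩
  have he := (hF.liftedGenerator_mem_iff hM hec).1 heF
  exact PointedCone.subset_hull (AddSubmonoid.subset_closure ⟨e, he.1, he.2, rfl⟩)

theorem weightComplex_isMonoidalComplex [Fintype E] (hM : M.IsMonoidalComplex) :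
    (M.weightComplex a w).IsMonoidalComplex where
  isConicalComplex := weightSubdivision_isConicalComplex hM
  integral d := by
    obtain ⟨F, hF, -⟩ := exists_isBottomFace d
    intro m hm
    have h : (M.weightComplex a w).monoid d ≤ M.monoid d.2.choose := by
      refine AddSubmonoid.closure_le.2 ?_
      rintro _ ⟨e, he, -, rfl⟩
      exact ((mem_monomial_iff hM (a e) _).2 (hF.subset he)).2
    exact hM.integral _ m (h hm)
  fg d := by
    refine AddSubmonoid.fg_iff _ |>.2 ⟨_, rfl, ?_⟩
    refine (Set.finite_range fun e => (M.weightSubdivision a w).chart d (a e).1).subset ?_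
    rintro _ ⟨e, -, -, rfl⟩
    exact ⟨e, rfl⟩
  hull_eq := weightComplex_hull_eq hM
  compat d d' x hx := ⟨weightComplex_mem_of_mem hM d d' hx.1 hx.2,
    weightComplex_mem_of_mem hM d' d hx.2 hx.1⟩

end MonoidSystem

/-! ### Monomial homomorphisms and presentations of toric face rings -/

section MonomialHom

variable {E V K : Type*} [Field K] [AddCommMonoid V]

open Classical in
/-- The homomorphism from a polynomial ring to a monoid algebra that maps `X_e` to the monomial with
exponent `v e` if `e ∈ S`, and to `0` otherwise. -/
noncomputable def monomialHom (K : Type*) [Field K] (S : Set E) (v : E → V) :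
    MvPolynomial E K →ₐ[K] AddMonoidAlgebra K V :=
  MvPolynomial.aeval fun e => if e ∈ S then AddMonoidAlgebra.single (v e) 1 else 0

variable {S : Set E} {v : E → V}

open Classical in
theorem monomialHom_monomial [Fintype E] (u : E →₀ ℕ) (k : K) :
    monomialHom K S v (MvPolynomial.monomial u k) =
      if (∀ e, u e ≠ 0 → e ∈ S) then AddMonoidAlgebra.single (∑ e, u e • v e) k else 0 := by
  rw [monomialHom, MvPolynomial.aeval_monomial, Finsupp.prod_fintype _ _ fun e => pow_zero _]
  split_ifs with h
  · have h1 : ∀ e ∈ Finset.univ,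
        (if e ∈ S then AddMonoidAlgebra.single (v e) (1 : K) else 0) ^ u e =
        AddMonoidAlgebra.single (u e • v e) 1 := fun e _ => by
      by_cases he : u e = 0
      · rw [he, pow_zero, zero_smul, AddMonoidAlgebra.one_def]
      · rw [if_pos (h e he), AddMonoidAlgebra.single_pow, one_pow]
    rw [Finset.prod_congr rfl h1, AddMonoidAlgebra.prod_single, Finset.prod_const_one]
    simp [Algebra.algebraMap_eq_smul_one]
  · push Not at h
    obtain ⟨e, he, heS⟩ := h
    rw [Finset.prod_eq_zero (Finset.mem_univ e), mul_zero]
    rw [if_neg heS, zero_pow he]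

/-- The exponents of the monomials in the `X_e` with `e ∈ S` that `monomialHom` maps to the monomial
with exponent `z`. -/
def exponentFiber [Fintype E] (S : Set E) (v : E → V) (z : V) : Set (E →₀ ℕ) :=
  {u | (∀ e, u e ≠ 0 → e ∈ S) ∧ ∑ e, u e • v e = z}

open Classical in
/-- The coefficients of the image of a polynomial under a monomial homomorphism. -/
theorem coeff_monomialHom [Fintype E] (f : MvPolynomial E K) (z : V) :
    (monomialHom K S v f).coeff z = ∑ u ∈ f.support with u ∈ exponentFiber S v z, f.coeff u := by
  conv_lhs => rw [f.as_sum, map_sum]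
  rw [AddMonoidAlgebra.coeff_sum, Finsupp.finsetSum_apply, Finset.sum_filter]
  refine Finset.sum_congr rfl fun u _ => ?_
  rw [monomialHom_monomial]
  by_cases h1 : ∀ e, u e ≠ 0 → e ∈ S
  · rw [if_pos h1, AddMonoidAlgebra.coeff_single, Finsupp.single_apply]
    by_cases h2 : ∑ e, u e • v e = z
    · rw [if_pos h2, if_pos ⟨h1, h2⟩]
    · rw [if_neg h2, if_neg fun h => h2 h.2]
  · rw [if_neg h1, if_neg fun h => h1 h.1]
    rfl

open Classical in
theorem mem_ker_monomialHom [Fintype E] {f : MvPolynomial E K} :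
    f ∈ RingHom.ker (monomialHom K S v) ↔
      ∀ z, ∑ u ∈ f.support with u ∈ exponentFiber S v z, f.coeff u = 0 := by
  rw [RingHom.mem_ker]
  simp only [← coeff_monomialHom]
  refine ⟨fun h z => by rw [h]; rfl, fun h => AddMonoidAlgebra.ext ?_⟩
  exact Finsupp.ext h

theorem monomialHom_congr {v' : E → V} (h : ∀ e ∈ S, v e = v' e) :
    monomialHom K S v = monomialHom K S v' := by
  classical
  refine MvPolynomial.algHom_ext fun e => ?_
  simp only [monomialHom, MvPolynomial.aeval_X]
  split_ifs with he
  · rw [h e he]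
  · rfl

end MonomialHom

namespace MonoidSystem

variable {X E : Type*} {M : MonoidSystem X}

open Classical in
/-- The homomorphism from `|M| ∪ {-∞}` to the monoid algebra of the ambient space of a face `c`
that keeps the exponents in `c` and maps the other ones to `0`. -/
noncomputable def restrictHom (K : Type*) [Field K] (M : MonoidSystem X)
    (hM : M.IsMonoidalComplex) (c : M.faces) :
    M.Exponents hM →* AddMonoidAlgebra K (Fin (M.dim c) → ℝ) where
  toFun o := Option.elim (o : Option M.Monomials) 0 fun m =>
    if m.1 ∈ c.1 then AddMonoidAlgebra.single (M.chart c m.1) 1 else 0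
  map_one' := by
    change Option.elim M.expOne _ _ = _
    obtain ⟨z, hz, hz0⟩ := (hM.isConicalComplex.bijOn c).surjOn (M.cone c).zero_mem
    let o : M.Monomials := ⟨z, c, hz, by rw [hz0]; exact (M.monoid c).zero_mem⟩
    have ho : M.expOne = some o := by
      -- `expOne` is some `b` with `b + o = o`, and `o` is a zero element, hence `b = o`.
      have h := expOne_mul hM (some o)
      obtain ⟨b, b', hb, hb', hs⟩ := (expMul_eq_some' hM).1 h
      obtain rfl := Option.some.inj hb'
      obtain ⟨hbc, -, -, hsum⟩ := hs.mem hM (d := c) hz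
      rw [hb]
      refine congrArg some (Subtype.ext ((hM.isConicalComplex.bijOn c).injOn hbc.1 hz ?_))
      exact (add_eq_right.1 hsum.symm).trans hz0.symm
    rw [ho, AddMonoidAlgebra.one_def, ← hz0]
    exact if_pos hz
  map_mul' := by
    intro (x : Option M.Monomials) (y : Option M.Monomials)
    change Option.elim (M.expMul x y) _ _ = _
    rcases x with _ | x
    · rw [expMul_none_left]
      exact (zero_mul _).symm
    rcases y with _ | y
    · rw [expMul_none_right]
      exact (mul_zero _).symm
    simp only [Option.elim_some]
    by_cases hx : x.1 ∈ c.1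
    · by_cases hy : y.1 ∈ c.1
      · obtain ⟨s, hs, hsc, hsum⟩ := exists_isSum hM ((mem_monomial_iff hM x c).2 hx)
          ((mem_monomial_iff hM y c).2 hy)
        rw [(expMul_eq_some hM).2 hs, if_pos hx, if_pos hy, AddMonoidAlgebra.single_mul_single,
          one_mul, ← hsum]
        exact if_pos hsc.1
      · rw [if_neg hy, mul_zero]
        rcases h : M.expMul (some x) (some y) with _ | s
        · rfl
        · exact if_neg fun hs => hy (((expMul_eq_some hM).1 h).mem hM hs).2.1.1
    · rw [if_neg hx, zero_mul]
      rcases h : M.expMul (some x) (some y) with _ | s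
      · rfl
      · exact if_neg fun hs => hx (((expMul_eq_some hM).1 h).mem hM hs).1.1

variable {K : Type*} [Field K]

theorem restrictHom_none (hM : M.IsMonoidalComplex) (c : M.faces) :
    restrictHom K M hM c (M.toExponents hM none) = 0 :=
  rfl

open Classical in
theorem restrictHom_some (hM : M.IsMonoidalComplex) (c : M.faces) (m : M.Monomials) :
    restrictHom K M hM c (M.toExponents hM (some m)) =
      if m.1 ∈ c.1 then AddMonoidAlgebra.single (M.chart c m.1) 1 else 0 :=
  rfl

/-- An element of the monoid algebra of `|M| ∪ {-∞}` that is mapped to zero by the restrictions to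
all faces is a multiple of `t^{-∞}`. -/
theorem mem_span_of_restrictHom (hM : M.IsMonoidalComplex)
    (g : MonoidAlgebra K (M.Exponents hM))
    (hg : ∀ c, MonoidAlgebra.lift K _ _ (restrictHom K M hM c) g = 0) :
    g ∈ Ideal.span {MonoidAlgebra.of K (M.Exponents hM) (M.toExponents hM none)} := by
  classical
  have h0 : ∀ m : M.Monomials, g.coeff (M.toExponents hM (some m)) = 0 := by
    intro m
    obtain ⟨c, hc⟩ := m.2
    have h := congrArg (fun q => q.coeff (M.chart c m.1)) (hg c)
    simp only [MonoidAlgebra.lift_apply] at h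
    rw [Finsupp.sum, AddMonoidAlgebra.coeff_sum, Finsupp.finsetSum_apply,
      Finset.sum_eq_single (M.toExponents hM (some m))] at h
    · rw [restrictHom_some, if_pos hc.1] at h
      simpa using h
    · intro o _ ho
      obtain rfl | ⟨n, rfl⟩ : o = M.toExponents hM none ∨
          ∃ n, o = M.toExponents hM (some n) := Option.eq_none_or_eq_some o
      · rw [restrictHom_none]
        simp
      · rw [restrictHom_some]
        split_ifs with hn
        · have h2 : M.chart c n.1 ≠ M.chart c m.1 := fun h => ho (congrArg some
            (Subtype.ext ((hM.isConicalComplex.bijOn c).injOn hn hc.1 h)))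
          simp [h2]
        · simp
    · intro hm
      rw [Finsupp.notMem_support_iff.1 hm]
      simp
  have h1 : g = MonoidAlgebra.single 1 (g.coeff (M.toExponents hM none)) *
      MonoidAlgebra.of K _ (M.toExponents hM none) := by
    rw [MonoidAlgebra.of_apply, MonoidAlgebra.single_mul_single, one_mul, mul_one]
    refine MonoidAlgebra.ext (Finsupp.ext fun o => ?_)
    rw [MonoidAlgebra.coeff_single, Finsupp.single_apply]
    rcases o with _ | m
    · exact (if_pos rfl).symm
    · rw [if_neg fun h => by cases h]
      exact h0 m
  rw [h1]
  exact Ideal.mul_mem_left _ _ (Ideal.subset_span rfl)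

/-- The toric face ring embeds into the product of the monoid algebras of the ambient spaces of the
faces. Hence the presentation ideal is the intersection of the (prime) kernels of the monomial
homomorphisms given by the faces. -/
theorem presentationIdeal_eq_iInf (hM : M.IsMonoidalComplex) (b : E → Option M.Monomials) :
    presentationIdeal K M hM b = ⨅ c : M.faces, RingHom.ker (monomialHom K
      {e | ∃ m, b e = some m ∧ m.1 ∈ c.1} fun e => (b e).elim 0 fun m => M.chart c m.1) := by
  classical
  -- Lift the presentation to the monoid algebra of the exponents.
  let β : MvPolynomial E K →ₐ[K] MonoidAlgebra K (M.Exponents hM) :=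
    MvPolynomial.aeval fun e => MonoidAlgebra.of K _ (M.toExponents hM (b e))
  let I := Ideal.span {MonoidAlgebra.of K (M.Exponents hM) (M.toExponents hM none)}
  have h1 : (MvPolynomial.aeval fun e => toricMonomial K M hM (b e)) =
      (Ideal.Quotient.mkₐ K I).comp β := by
    refine MvPolynomial.algHom_ext fun e => ?_
    simp only [MvPolynomial.aeval_X, AlgHom.comp_apply, β]
    rfl
  have h2 : ∀ c : M.faces, monomialHom K {e | ∃ m, b e = some m ∧ m.1 ∈ c.1}
      (fun e => (b e).elim 0 fun m => M.chart c m.1) =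
      (MonoidAlgebra.lift K _ _ (restrictHom K M hM c)).comp β := by
    intro c
    refine MvPolynomial.algHom_ext fun e => ?_
    simp only [monomialHom, MvPolynomial.aeval_X, AlgHom.comp_apply, β, MonoidAlgebra.lift_of]
    obtain h | ⟨m, h⟩ := Option.eq_none_or_eq_some (b e)
    · simp only [h, restrictHom_none]
      exact if_neg (by rintro ⟨m, hm, -⟩; rw [h] at hm; cases hm)
    · simp [h, restrictHom_some]
  have h3 : ∀ c : M.faces, I ≤ RingHom.ker (MonoidAlgebra.lift K _ _ (restrictHom K M hM c)) := by
    intro c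
    rw [Ideal.span_le, Set.singleton_subset_iff]
    exact MonoidAlgebra.lift_of _ _
  ext f
  rw [Ideal.mem_iInf]
  simp only [h2]
  rw [presentationIdeal, h1]
  simp only [RingHom.mem_ker, AlgHom.comp_apply, Ideal.Quotient.mkₐ_eq_mk,
    Ideal.Quotient.eq_zero_iff_mem]
  exact ⟨fun hf c => h3 c hf, mem_span_of_restrictHom hM _⟩

theorem presentationIdeal_isRadical (hM : M.IsMonoidalComplex) (b : E → Option M.Monomials) :
    (presentationIdeal K M hM b).IsRadical := by
  rw [presentationIdeal_eq_iInf]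
  exact Ideal.isRadical_iInf _ fun c => (RingHom.ker_isPrime _).isRadical

end MonoidSystem

/-! ### Initial components of binomials -/

section InitialComponent

variable {E K : Type*} [Field K] {w : E → ℕ}

theorem initialComponent_of_isWeightedHomogeneous {f : MvPolynomial E K} {n : ℕ}
    (hf : MvPolynomial.IsWeightedHomogeneous w f n) : initialComponent w f = f := by
  by_cases h0 : f = 0
  · rw [h0, initialComponent, map_zero]
  · have h := hf.weighted_total_degree h0
    rw [MvPolynomial.weightedTotalDegree_coe w f h0] at h
    rw [initialComponent, WithBot.coe_injective h]
    exact hf.weightedHomogeneousComponent_same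

theorem initialComponent_sub_of_lt {u v : E →₀ ℕ}
    (h : Finsupp.weight w v < Finsupp.weight w u) :
    initialComponent w (MvPolynomial.monomial u (1 : K) - MvPolynomial.monomial v 1) =
      MvPolynomial.monomial u 1 := by
  classical
  have hne : v ≠ u := fun huv => h.ne (by rw [huv])
  have hdeg : MvPolynomial.weightedTotalDegree w
      (MvPolynomial.monomial u (1 : K) - MvPolynomial.monomial v 1) = Finsupp.weight w u := by
    apply le_antisymm
    · refine Finset.sup_le fun m hm => ?_
      rw [MvPolynomial.mem_support_iff, MvPolynomial.coeff_sub, MvPolynomial.coeff_monomial,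
        MvPolynomial.coeff_monomial] at hm
      by_cases hum : u = m
      · rw [hum]
      · by_cases hvm : v = m
        · rw [← hvm]
          exact h.le
        · simp [hum, hvm] at hm
    · refine MvPolynomial.le_weightedTotalDegree w ?_
      rw [MvPolynomial.mem_support_iff, MvPolynomial.coeff_sub, MvPolynomial.coeff_monomial,
        MvPolynomial.coeff_monomial, if_pos rfl, if_neg hne]
      simp
  rw [initialComponent, hdeg, map_sub,
    (MvPolynomial.isWeightedHomogeneous_monomial w u (1 : K) rfl).weightedHomogeneousComponent_same,
    (MvPolynomial.isWeightedHomogeneous_monomial w v (1 : K) rfl).weightedHomogeneousComponent_ne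
      _ h.ne', sub_zero]

end InitialComponent

namespace MonoidSystem

variable {X E : Type*} {M : MonoidSystem X} {a : E → M.Monomials} {w : E → ℕ}
  {K : Type*} [Field K]

/-! ### The two presentation ideals -/

theorem presentationIdeal_some_eq_iInf (hM : M.IsMonoidalComplex) :
    presentationIdeal K M hM (fun e => some (a e)) = ⨅ c : M.faces,
      RingHom.ker (monomialHom K {e | (a e).1 ∈ c.1} fun e => M.chart c (a e).1) := by
  rw [presentationIdeal_eq_iInf]
  refine iInf_congr fun c => ?_
  have : {e | ∃ m, some (a e) = some m ∧ m.1 ∈ c.1} = {e | (a e).1 ∈ c.1} := by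
    ext e
    simp
  rw [this]
  rfl

theorem presentationIdeal_weightFamily_eq_iInf (hw : (M.weightComplex a w).IsMonoidalComplex) :
    presentationIdeal K (M.weightComplex a w) hw (M.weightFamily a w) =
      ⨅ d : (M.weightSubdivision a w).faces, RingHom.ker (monomialHom K
        {e | (a e).1 ∈ d.1 ∧ M.height a w (a e).1 = w e}
        fun e => M.chart d.2.choose (a e).1) := by
  rw [presentationIdeal_eq_iInf]
  refine iInf_congr fun d => ?_
  have h1 : ∀ e, (a e).1 ∈ d.1 ∧ M.height a w (a e).1 = w e →
      ∃ h, M.weightFamily a w e = some ⟨(a e).1, h⟩ := by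
    rintro e ⟨hd, he⟩
    have h : ∃ d, (M.weightComplex a w).Mem d (a e).1 :=
      ⟨d, hd, AddSubmonoid.subset_closure ⟨e, hd, he, rfl⟩⟩
    exact ⟨h, dif_pos ⟨he, h⟩⟩
  have h2 : {e | ∃ m, M.weightFamily a w e = some m ∧ m.1 ∈ d.1} =
      {e | (a e).1 ∈ d.1 ∧ M.height a w (a e).1 = w e} := by
    ext e
    constructor
    · rintro ⟨m, hm, hmd⟩
      unfold weightFamily at hm
      split_ifs at hm with h
      obtain rfl := Option.some.inj hm
      exact ⟨hmd, h.1⟩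
    · intro he
      obtain ⟨h, hh⟩ := h1 e he
      exact ⟨_, hh, he.1⟩
  rw [h2]
  refine congrArg _ (monomialHom_congr fun e he => ?_)
  obtain ⟨h, hh⟩ := h1 e he
  rw [hh]
  rfl

theorem sum_natCast_smul_liftedGenerator [Fintype E] {c : M.faces} (u : E →₀ ℕ) :
    ∑ e, (u e : ℝ) • M.liftedGenerator a w c e =
      (∑ e, u e • M.chart c (a e).1, (Finsupp.weight w u : ℝ)) := by
  rw [sum_smul_liftedGenerator, Finsupp.weight_apply, Finsupp.sum_fintype _ _ (by simp)]
  simp [Nat.cast_smul_eq_nsmul]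

theorem mem_liftedCone_of_exponent [Fintype E] {c : M.faces} {u : E →₀ ℕ}
    (hu : ∀ e, u e ≠ 0 → (a e).1 ∈ c.1) :
    (∑ e, u e • M.chart c (a e).1, (Finsupp.weight w u : ℝ)) ∈ M.liftedCone a w c := by
  rw [← sum_natCast_smul_liftedGenerator]
  exact mem_liftedCone.2 ⟨_, fun e => Nat.cast_nonneg _,
    fun e he => hu e (Nat.cast_ne_zero.1 he), rfl⟩

/-- Two monomials in generators from a face `c` with the same value in `M_c` have the same value
in every other face: they are supported in the same faces. -/
theorem exponent_transfer [Fintype E] (hM : M.IsMonoidalComplex) {c c' : M.faces} {u v : E →₀ ℕ}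
    (hu : ∀ e, u e ≠ 0 → (a e).1 ∈ c.1) (hv : ∀ e, v e ≠ 0 → (a e).1 ∈ c.1)
    (huv : ∑ e, u e • M.chart c (a e).1 = ∑ e, v e • M.chart c (a e).1)
    (hu' : ∀ e, u e ≠ 0 → (a e).1 ∈ c'.1) :
    (∀ e, v e ≠ 0 → (a e).1 ∈ c'.1) ∧
      ∑ e, u e • M.chart c' (a e).1 = ∑ e, v e • M.chart c' (a e).1 := by
  obtain ⟨A, L, hA, hcA, hL⟩ := hM.isConicalComplex.exists_transition c c'
  have huA : ∑ e, u e • M.chart c (a e).1 ∈ A := by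
    refine A.sum_mem fun e _ => ?_
    by_cases he : u e = 0
    · simp [he]
    · exact A.nsmul_mem (hcA ▸ ⟨hu e he, hu' e he⟩ :
        (a e).1 ∈ M.toConeSystem.part c A).2 _
  have hv' : ∀ e, v e ≠ 0 → (a e).1 ∈ c'.1 := by
    intro e he
    refine (hcA.superset ⟨hv e he, ?_⟩ : (a e).1 ∈ c.1 ∩ c'.1).2
    refine hA.mem_of_sum (l := fun e => (v e : ℝ)) (g := fun e => M.chart c (a e).1)
      (fun e => Nat.cast_nonneg _)
      (fun e he => (hM.isConicalComplex.bijOn c).mapsTo (hv e (Nat.cast_ne_zero.1 he))) ?_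
      (Nat.cast_ne_zero.2 he)
    simpa only [Nat.cast_smul_eq_nsmul, ← huv] using huA
  have hsum : ∀ q : E →₀ ℕ, (∀ e, q e ≠ 0 → (a e).1 ∈ c.1) →
      (∀ e, q e ≠ 0 → (a e).1 ∈ c'.1) →
      ∑ e, q e • M.chart c' (a e).1 = L (∑ e, q e • M.chart c (a e).1) := by
    intro q hq hq'
    rw [map_sum]
    refine Finset.sum_congr rfl fun e _ => ?_
    by_cases he : q e = 0
    · simp [he]
    · rw [map_nsmul, hL _ (hq e he) (hq' e he)]
  exact ⟨hv', by rw [hsum u hu hu', hsum v hv hv', huv]⟩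

theorem binomial_mem_presentationIdeal [Fintype E] (hM : M.IsMonoidalComplex) {c : M.faces}
    {u v : E →₀ ℕ} (hu : ∀ e, u e ≠ 0 → (a e).1 ∈ c.1) (hv : ∀ e, v e ≠ 0 → (a e).1 ∈ c.1)
    (huv : ∑ e, u e • M.chart c (a e).1 = ∑ e, v e • M.chart c (a e).1) :
    MvPolynomial.monomial u (1 : K) - MvPolynomial.monomial v 1 ∈
      presentationIdeal K M hM (fun e => some (a e)) := by
  rw [presentationIdeal_some_eq_iInf, Ideal.mem_iInf]
  intro c'
  rw [RingHom.mem_ker, map_sub, sub_eq_zero, monomialHom_monomial, monomialHom_monomial]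
  by_cases h : ∀ e, u e ≠ 0 → (a e).1 ∈ c'.1
  · obtain ⟨h1, h2⟩ := exponent_transfer hM hu hv huv h
    exact (if_pos h).trans ((congrArg (AddMonoidAlgebra.single · 1) h2).trans (if_pos h1).symm)
  · exact (if_neg h).trans
      (if_neg fun h' => h (exponent_transfer hM hv hu huv.symm h').1).symm

/-! ### The initial ideal is contained in the presentation ideal of the subdivided complex -/

/-- For each point `z` below a bottom face, the terms of `in_w(f)` with value `z` in `K[M_w]` are
exactly the terms of `f` with value `z` in `K[M]`, unless there are none of the former: all
monomials over `z` have weight at least the height of `z`, and equality holds exactly for those in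
generators from the bottom face. -/
theorem initialComponent_mem_presentationIdeal [Fintype E] (hM : M.IsMonoidalComplex)
    (hw : (M.weightComplex a w).IsMonoidalComplex) {f : MvPolynomial E K}
    (hf : f ∈ presentationIdeal K M hM (fun e => some (a e))) :
    initialComponent w f ∈
      presentationIdeal K (M.weightComplex a w) hw (M.weightFamily a w) := by
  classical
  rw [presentationIdeal_some_eq_iInf, Ideal.mem_iInf] at hf
  rw [presentationIdeal_weightFamily_eq_iInf, Ideal.mem_iInf]
  intro d
  obtain ⟨F, hF, -⟩ := exists_isBottomFace d
  have hfc := mem_ker_monomialHom.1 (hf d.2.choose)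
  rw [mem_ker_monomialHom]
  intro z
  have hsupp : (initialComponent w f).support = {u ∈ f.support |
      Finsupp.weight w u = MvPolynomial.weightedTotalDegree w f} :=
    MvPolynomial.support_weightedHomogeneousComponent _ _
  by_cases hex : ∃ u ∈ (initialComponent w f).support, u ∈ exponentFiber
      {e | (a e).1 ∈ d.1 ∧ M.height a w (a e).1 = w e} (fun e => M.chart d.2.choose (a e).1) z
  · obtain ⟨u, hu, huS, huz⟩ := hex
    rw [hsupp, Finset.mem_filter] at hu
    have hzF : (z, ((MvPolynomial.weightedTotalDegree w f : ℕ) : ℝ)) ∈ F := by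
      rw [← huz, ← hu.2, ← sum_natCast_smul_liftedGenerator]
      refine F.sum_mem fun e _ => ?_
      by_cases he : u e = 0
      · simp [he]
      · exact F.smul_mem (Nat.cast_nonneg _)
          ((hF.liftedGenerator_mem_iff hM (hF.subset (huS e he).1)).2 (huS e he))
    rw [← hfc z]
    have hfilter : {v ∈ (initialComponent w f).support | v ∈ exponentFiber
        {e | (a e).1 ∈ d.1 ∧ M.height a w (a e).1 = w e}
        (fun e => M.chart d.2.choose (a e).1) z} =
        {v ∈ f.support | v ∈ exponentFiber {e | (a e).1 ∈ d.2.choose.1}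
          (fun e => M.chart d.2.choose (a e).1) z} := by
      ext v
      rw [Finset.mem_filter, Finset.mem_filter, hsupp, Finset.mem_filter]
      constructor
      · rintro ⟨⟨hv, -⟩, hvS, hvz⟩
        exact ⟨hv, fun e he => hF.subset (hvS e he).1, hvz⟩
      · rintro ⟨hv, hvS, hvz⟩
        have h1 := mem_liftedCone_of_exponent (w := w) hvS
        have h2 := (hF.subset_bottom hzF).2 _ h1 hvz
        have h3 : Finsupp.weight w v = MvPolynomial.weightedTotalDegree w f :=
          le_antisymm (MvPolynomial.le_weightedTotalDegree w hv) (Nat.cast_le.1 h2)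
        refine ⟨⟨hv, h3⟩, fun e he => ?_, hvz⟩
        refine (hF.liftedGenerator_mem_iff hM (hvS e he)).1 ?_
        refine hF.isFaceOf.mem_of_sum (l := fun e => (v e : ℝ)) (fun e => Nat.cast_nonneg _)
          (fun e he => liftedGenerator_mem (hvS e (Nat.cast_ne_zero.1 he))) ?_
          (Nat.cast_ne_zero.2 he)
        rw [sum_natCast_smul_liftedGenerator, hvz, h3]
        exact hzF
    rw [← hfilter]
    refine Finset.sum_congr rfl fun v hv => ?_
    have hv' := (Finset.mem_filter.1 hv).1
    rw [hsupp, Finset.mem_filter] at hv'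
    rw [initialComponent, MvPolynomial.coeff_weightedHomogeneousComponent, if_pos hv'.2]
  · refine Finset.sum_eq_zero fun u hu => ?_
    rw [Finset.mem_filter] at hu
    exact absurd ⟨u, hu⟩ hex

/-! ### Monomials in the radical of the initial ideal -/

/-- If a point of `C'_c` lies strictly below the lift of a monomial `X^u`, then some power of `X^u`
has the same value in `M_c` as a monomial `X^v` of smaller weight. -/
theorem exists_exponent_of_lt [Fintype E] (hM : M.IsMonoidalComplex) {c : M.faces} {u : E →₀ ℕ}
    (hu : ∀ e, u e ≠ 0 → (a e).1 ∈ c.1) {q : (Fin (M.dim c) → ℝ) × ℝ}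
    (hq : q ∈ M.liftedCone a w c) (hqu : q.1 = ∑ e, u e • M.chart c (a e).1)
    (hlt : q.2 < Finsupp.weight w u) :
    ∃ (N : ℕ) (v : E →₀ ℕ), (∀ e, v e ≠ 0 → (a e).1 ∈ c.1) ∧
      ∑ e, (N • u) e • M.chart c (a e).1 = ∑ e, v e • M.chart c (a e).1 ∧
      Finsupp.weight w v < Finsupp.weight w (N • u) := by
  obtain ⟨l, hl, hlc, rfl⟩ := mem_liftedCone.1 hq
  rw [sum_smul_liftedGenerator] at hqu hlt
  simp only at hqu hlt
  -- Approximate `N * l` by `v` so well that the errors in all coordinates, which are integers, are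
  -- less than `1`, and that the error in the weight is less than the difference of the heights.
  set δ : ℝ := Finsupp.weight w u - ∑ e, l e * w e with hδ
  have hδ0 : 0 < δ := sub_pos.2 hlt
  set B : ℝ := 1 + ∑ e, ((w e : ℝ) + ∑ i, |M.chart c (a e).1 i|) with hB
  have hB0 : 0 < B := by positivity
  obtain ⟨N, v, hN, happ, hv0⟩ :=
    exists_nat_simultaneous_approx l hl (div_pos (lt_min one_pos hδ0) hB0)
  have hvc : ∀ e, v e ≠ 0 → (a e).1 ∈ c.1 := fun e he => hlc e fun h => he (hv0 e h)
  have herr : ∀ g : E → ℝ, (∑ e, |g e| < B) → |∑ e, ((v e : ℝ) - N * l e) * g e| < min 1 δ := by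
    intro g hg
    calc |∑ e, ((v e : ℝ) - N * l e) * g e|
        ≤ ∑ e, min 1 δ / B * |g e| := by
          refine (Finset.abs_sum_le_sum_abs _ _).trans (Finset.sum_le_sum fun e _ => ?_)
          rw [abs_mul]
          exact mul_le_mul_of_nonneg_right (happ e).le (abs_nonneg _)
      _ = min 1 δ / B * ∑ e, |g e| := by rw [Finset.mul_sum]
      _ < min 1 δ / B * B :=
          mul_lt_mul_of_pos_left hg (div_pos (lt_min one_pos hδ0) hB0)
      _ = min 1 δ := div_mul_cancel₀ _ hB0.ne'
  have hwt : ∀ t : E →₀ ℕ, (Finsupp.weight w t : ℝ) = ∑ e, (t e : ℝ) * w e := fun t => by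
    rw [Finsupp.weight_apply, Finsupp.sum_fintype _ _ (by simp)]
    simp
  refine ⟨N, Finsupp.equivFunOnFinite.symm v, hvc, ?_, ?_⟩
  · funext i
    choose! k hk using fun e (he : (a e).1 ∈ c.1) =>
      hM.integral c _ ((mem_monomial_iff hM (a e) c).2 he).2 i
    have hqi := congrFun hqu i
    simp only [Finset.sum_apply, Pi.smul_apply] at hqi ⊢
    simp only [smul_eq_mul, nsmul_eq_mul, Finsupp.smul_apply,
      Finsupp.equivFunOnFinite_symm_apply_apply] at hqi ⊢
    have h1 := herr (fun e => M.chart c (a e).1 i) (by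
      rw [hB, ← zero_add (∑ e, |M.chart c (a e).1 i|)]
      refine add_lt_add_of_lt_of_le zero_lt_one (Finset.sum_le_sum fun e _ => ?_)
      have := Finset.single_le_sum (f := fun i => |M.chart c (a e).1 i|)
        (fun i _ => abs_nonneg _) (Finset.mem_univ i)
      have h0 : (0 : ℝ) ≤ w e := Nat.cast_nonneg _
      linarith)
    have h2 : ∑ e, ((v e : ℝ) - N * l e) * M.chart c (a e).1 i =
        ((∑ e, ((v e : ℤ) - N * u e) * k e : ℤ) : ℝ) := by
      have h3 : ∀ t : E → ℕ, (∀ e, t e ≠ 0 → (a e).1 ∈ c.1) →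
          ∑ e, (t e : ℝ) * M.chart c (a e).1 i = ∑ e, (t e : ℝ) * k e := by
        refine fun t ht => Finset.sum_congr rfl fun e _ => ?_
        by_cases he : t e = 0
        · simp [he]
        · rw [hk e (ht e he)]
      push_cast
      simp only [sub_mul, Finset.sum_sub_distrib, mul_assoc, ← Finset.mul_sum]
      rw [hqi, h3 v hvc, h3 u hu]
    have h4 : (∑ e, ((v e : ℤ) - N * u e) * k e : ℤ) = 0 := by
      rw [h2] at h1
      exact Int.abs_lt_one_iff.1 (by exact_mod_cast h1.trans_le (min_le_left _ _))
    rw [h4, Int.cast_zero] at h2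
    simp only [sub_mul, Finset.sum_sub_distrib, mul_assoc, ← Finset.mul_sum, hqi] at h2
    push_cast
    simp only [mul_assoc, ← Finset.mul_sum]
    linarith
  · have h1 := herr (fun e => (w e : ℝ)) (by
      rw [hB, ← zero_add (∑ e, |(w e : ℝ)|)]
      refine add_lt_add_of_lt_of_le zero_lt_one (Finset.sum_le_sum fun e _ => ?_)
      rw [Nat.abs_cast]
      exact le_add_of_nonneg_right (Finset.sum_nonneg fun i _ => abs_nonneg _))
    have h2 := (le_abs_self _).trans_lt (h1.trans_le (min_le_right _ _))
    simp only [sub_mul, Finset.sum_sub_distrib, mul_assoc, ← Finset.mul_sum] at h2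
    rw [← Nat.cast_lt (α := ℝ), map_nsmul, smul_eq_mul, Nat.cast_mul, hwt]
    simp only [Finsupp.equivFunOnFinite_symm_apply_apply]
    have h3 : (1 : ℝ) ≤ N := by exact_mod_cast hN
    have h4 : δ ≤ N * δ := le_mul_of_one_le_left hδ0.le h3
    rw [hδ] at h2 h4
    nlinarith

/-- A monomial that is mapped to zero in `K[M_w]` has a power in the initial ideal. -/
theorem monomial_mem_radical_initialIdeal [Fintype E] (hM : M.IsMonoidalComplex) {u : E →₀ ℕ}
    (hu : ∀ d : (M.weightSubdivision a w).faces,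
      ¬ ∀ e, u e ≠ 0 → (a e).1 ∈ d.1 ∧ M.height a w (a e).1 = w e) :
    MvPolynomial.monomial u (1 : K) ∈
      (initialIdeal w (presentationIdeal K M hM (fun e => some (a e)))).radical := by
  by_cases hc : ∃ c : M.faces, ∀ e, u e ≠ 0 → (a e).1 ∈ c.1
  · obtain ⟨c, hc⟩ := hc
    have hp := mem_liftedCone_of_exponent (w := w) hc
    by_cases hbot : (∑ e, u e • M.chart c (a e).1, (Finsupp.weight w u : ℝ)) ∈ M.bottom a w c
    · exfalso
      obtain ⟨F, hF, hFb, huF⟩ := exists_face_subset_bottom hbot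
      have hd : M.IsBottomFace a w c F _ := ⟨hF, hFb, rfl⟩
      refine hu ⟨_, hd.mem_faces⟩ fun e he => ?_
      refine (hd.liftedGenerator_mem_iff hM (hc e he)).1 ?_
      rw [← sum_natCast_smul_liftedGenerator] at huF
      exact hF.mem_of_sum (fun e => Nat.cast_nonneg _)
        (fun e he => liftedGenerator_mem (hc e (Nat.cast_ne_zero.1 he))) huF
        (Nat.cast_ne_zero.2 he)
    · have hlow : ∃ q ∈ M.liftedCone a w c, q.1 = ∑ e, u e • M.chart c (a e).1 ∧
          q.2 < Finsupp.weight w u := by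
        by_contra! h
        exact hbot ⟨hp, h⟩
      obtain ⟨q, hq, hqu, hlt⟩ := hlow
      obtain ⟨N, v, hv, hsum, hlt'⟩ := exists_exponent_of_lt hM hc hq hqu hlt
      refine ⟨N, ?_⟩
      rw [MvPolynomial.monomial_pow, one_pow, ← initialComponent_sub_of_lt hlt']
      refine Ideal.subset_span ⟨_, binomial_mem_presentationIdeal hM (fun e he => hc e ?_) hv hsum,
        rfl⟩
      exact fun h => he (by simp [h])
  · refine Ideal.le_radical (Ideal.subset_span ⟨_, ?_,
      initialComponent_of_isWeightedHomogeneous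
        (MvPolynomial.isWeightedHomogeneous_monomial w u 1 rfl)⟩)
    rw [SetLike.mem_coe, presentationIdeal_some_eq_iInf, Ideal.mem_iInf]
    intro c
    rw [RingHom.mem_ker, monomialHom_monomial]
    exact if_neg fun h => hc ⟨c, h⟩

/-- Two monomials with the same value in `N_{d,w}` have the same weight, as the height is linear on
`D_d`. Hence their difference is its own initial component. -/
theorem binomial_mem_initialIdeal [Fintype E] (hM : M.IsMonoidalComplex)
    (d : (M.weightSubdivision a w).faces) {u v : E →₀ ℕ}
    (hu : ∀ e, u e ≠ 0 → (a e).1 ∈ d.1 ∧ M.height a w (a e).1 = w e)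
    (hv : ∀ e, v e ≠ 0 → (a e).1 ∈ d.1 ∧ M.height a w (a e).1 = w e)
    (huv : ∑ e, u e • M.chart d.2.choose (a e).1 = ∑ e, v e • M.chart d.2.choose (a e).1) :
    MvPolynomial.monomial u (1 : K) - MvPolynomial.monomial v 1 ∈
      initialIdeal w (presentationIdeal K M hM (fun e => some (a e))) := by
  obtain ⟨F, hF, -⟩ := exists_isBottomFace d
  have hbot : ∀ t : E →₀ ℕ, (∀ e, t e ≠ 0 → (a e).1 ∈ d.1 ∧ M.height a w (a e).1 = w e) →
      (∑ e, t e • M.chart d.2.choose (a e).1, (Finsupp.weight w t : ℝ)) ∈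
        M.bottom a w d.2.choose := by
    intro t ht
    apply hF.subset_bottom
    rw [← sum_natCast_smul_liftedGenerator]
    refine F.sum_mem fun e _ => ?_
    by_cases he : t e = 0
    · simp [he]
    · exact F.smul_mem (Nat.cast_nonneg _)
        ((hF.liftedGenerator_mem_iff hM (hF.subset (ht e he).1)).2 (ht e he))
  have hw : Finsupp.weight w v = Finsupp.weight w u := by
    have h1 := (hbot u hu).2 _ (hbot v hv).1 huv.symm
    have h2 := (hbot v hv).2 _ (hbot u hu).1 huv
    have h3 : (Finsupp.weight w v : ℝ) = Finsupp.weight w u := le_antisymm h2 h1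
    exact_mod_cast h3
  exact Ideal.subset_span ⟨_, binomial_mem_presentationIdeal hM
    (fun e he => hF.subset (hu e he).1) (fun e he => hF.subset (hv e he).1) huv,
    initialComponent_of_isWeightedHomogeneous
      ((MvPolynomial.isWeightedHomogeneous_monomial w u 1 rfl).sub
        (MvPolynomial.isWeightedHomogeneous_monomial w v 1 hw))⟩

/-- The part of a polynomial `f` in the kernel for `M_w` that collects the terms with the same value
as a given term lies in the radical of the initial ideal. -/
theorem exists_subset_support_sum_mem_radical [Fintype E] (hM : M.IsMonoidalComplex)
    (hw : (M.weightComplex a w).IsMonoidalComplex) {f : MvPolynomial E K}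
    (hf : f ∈ presentationIdeal K (M.weightComplex a w) hw (M.weightFamily a w))
    {u : E →₀ ℕ} (hu : u ∈ f.support) :
    ∃ T ⊆ f.support, u ∈ T ∧ ∑ v ∈ T, MvPolynomial.monomial v (f.coeff v) ∈
      (initialIdeal w (presentationIdeal K M hM (fun e => some (a e)))).radical := by
  classical
  have hmon : ∀ (v : E →₀ ℕ) (k : K),
      MvPolynomial.monomial v k = MvPolynomial.C k * MvPolynomial.monomial v 1 := fun v k => by
    rw [MvPolynomial.C_mul_monomial, mul_one]
  by_cases hd : ∃ d : (M.weightSubdivision a w).faces,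
      ∀ e, u e ≠ 0 → (a e).1 ∈ d.1 ∧ M.height a w (a e).1 = w e
  · obtain ⟨d, hd⟩ := hd
    rw [presentationIdeal_weightFamily_eq_iInf, Ideal.mem_iInf] at hf
    have hsum := mem_ker_monomialHom.1 (hf d) (∑ e, u e • M.chart d.2.choose (a e).1)
    have huz : u ∈ exponentFiber {e | (a e).1 ∈ d.1 ∧ M.height a w (a e).1 = w e}
      (fun e => M.chart d.2.choose (a e).1) (∑ e, u e • M.chart d.2.choose (a e).1) := ⟨hd, rfl⟩
    refine ⟨_, Finset.filter_subset _ _, Finset.mem_filter.2 ⟨hu, huz⟩, ?_⟩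
    have h : ∀ T : Finset (E →₀ ℕ), ∑ v ∈ T, f.coeff v = 0 →
        ∑ v ∈ T, MvPolynomial.monomial v (f.coeff v) = ∑ v ∈ T, MvPolynomial.C (f.coeff v) *
          (MvPolynomial.monomial v 1 - MvPolynomial.monomial u 1) := by
      intro T hT
      simp only [mul_sub, ← hmon, Finset.sum_sub_distrib]
      rw [← map_sum, hT, map_zero, sub_zero]
    rw [h _ hsum]
    refine Ideal.sum_mem _ fun v hv => Ideal.mul_mem_left _ _ (Ideal.le_radical ?_)
    obtain ⟨-, hv, hvu⟩ := Finset.mem_filter.1 hv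
    exact binomial_mem_initialIdeal hM d hv hd hvu
  · refine ⟨{u}, Finset.singleton_subset_iff.2 hu, Finset.mem_singleton_self u, ?_⟩
    rw [Finset.sum_singleton, hmon]
    exact Ideal.mul_mem_left _ _ (monomial_mem_radical_initialIdeal hM (not_exists.1 hd))

theorem presentationIdeal_le_radical_initialIdeal [Fintype E] (hM : M.IsMonoidalComplex)
    (hw : (M.weightComplex a w).IsMonoidalComplex)
    (hle : (initialIdeal w (presentationIdeal K M hM (fun e => some (a e)))).radical ≤
      presentationIdeal K (M.weightComplex a w) hw (M.weightFamily a w)) :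
    presentationIdeal K (M.weightComplex a w) hw (M.weightFamily a w) ≤
      (initialIdeal w (presentationIdeal K M hM (fun e => some (a e)))).radical := by
  classical
  intro f hf
  -- Split off the terms with a common value, and use induction on the number of terms.
  induction hn : f.support.card using Nat.strong_induction_on generalizing f with
  | _ n ih =>
  rcases f.support.eq_empty_or_nonempty with h0 | ⟨u, hu⟩
  · rw [MvPolynomial.support_eq_empty.1 h0]
    exact Ideal.zero_mem _
  obtain ⟨T, hTf, huT, hT⟩ := exists_subset_support_sum_mem_radical hM hw hf hu
  set g := ∑ v ∈ T, MvPolynomial.monomial v (f.coeff v) with hg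
  have hcoeff : ∀ m, g.coeff m = if m ∈ T then f.coeff m else 0 := fun m => by
    rw [hg, MvPolynomial.coeff_sum]
    simp [MvPolynomial.coeff_monomial]
  have hsub : (f - g).support ⊆ f.support \ T := by
    intro m hm
    rw [MvPolynomial.mem_support_iff, MvPolynomial.coeff_sub, hcoeff] at hm
    by_cases hmT : m ∈ T
    · simp [hmT] at hm
    · simp only [hmT, if_false, sub_zero] at hm
      exact Finset.mem_sdiff.2 ⟨MvPolynomial.mem_support_iff.2 hm, hmT⟩
  have hlt : (f - g).support.card < n := by
    rw [← hn]
    refine Finset.card_lt_card (Finset.ssubset_iff_of_subset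
      (hsub.trans Finset.sdiff_subset) |>.2 ⟨u, hu, fun h => ?_⟩)
    exact (Finset.mem_sdiff.1 (hsub h)).2 huT
  have := Ideal.add_mem _ (ih _ hlt (Ideal.sub_mem _ hf (hle hT)) rfl) hT
  rwa [sub_add_cancel] at this

end MonoidSystem

theorem theorem3p6 {X : Type*} {K : Type*} [Field K] {E : Type*} [Finite E]
    (M : MonoidSystem X) (hM : M.IsMonoidalComplex)
    (a : E → M.Monomials) (ha : M.Generates a) (w : E → ℕ) :
    ∃ hw : (M.weightComplex a w).IsMonoidalComplex,
      MonoidSystem.presentationIdeal K (M.weightComplex a w) hw (M.weightFamily a w) =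
        (initialIdeal w (MonoidSystem.presentationIdeal K M hM (fun e => some (a e)))).radical := by
  have := Fintype.ofFinite E
  have hw := MonoidSystem.weightComplex_isMonoidalComplex (a := a) (w := w) hM
  have hle : (initialIdeal w
      (MonoidSystem.presentationIdeal K M hM (fun e => some (a e)))).radical ≤
      MonoidSystem.presentationIdeal K (M.weightComplex a w) hw (M.weightFamily a w) := by
    refine (MonoidSystem.presentationIdeal_isRadical hw _).radical_le_iff.2 (Ideal.span_le.2 ?_)
    rintro _ ⟨f, hf, rfl⟩
    exact MonoidSystem.initialComponent_mem_presentationIdeal hM hw hf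
  exact ⟨hw, le_antisymm
    (MonoidSystem.presentationIdeal_le_radical_initialIdeal hM hw hle) hle⟩
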